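/- Let $\mathcal G=(G^0,\mathcal G^1,r,s)$ be an ultragraph: $G^0,\mathcal G^1$ are countable sets, $s:\mathcal G^1\to G^0$, and $r:\mathcal G^1\to \mathcal P(G^0)\setminus\{\emptyset\}$. Let $\mathcal B$ be the smallest family of subsets of $G^0$ containing $\emptyset$, all singletons and all $r(e)$, and closed under finite unions, finite intersections and relative complements. A finite path is a word $\alpha=e_1\cdots e_k$ in $\mathcal G^1$ with $s(e_{i+1})\in r(e_i)$, with range $r(\alpha)=r(e_k)$; the empty word $\omega$ is allowed, with $r(\omega)=G^0$. Infinite paths are defined in the same way. Put $\mathcal B_\alpha=\{A\in\mathcal B : A\subseteq r(\alpha)\}$. For $A\subseteq G^0$ let $r(A,\omega)=A$ and, for $\gamma=e_1\cdots e_k$ with $k\ge 1$, let $r(A,\gamma)=r(\gamma)$ if $s(e_1)\in A$ and $r(A,\gamma)=\emptyset$ otherwise. Let $S$ be the inverse semigroup of all triples $(\alpha,A,\beta)$ with $\alpha,\beta$ finite paths and $\emptyset\ne A\in\mathcal B_\alpha\cap\mathcal B_\beta$, together with $0$, where $(\alpha,A,\beta)(\beta\gamma',B,\delta)=(\alpha\gamma',r(A,\gamma')\cap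 B,\delta)$ and $(\alpha,A,\gamma\beta')(\gamma,B,\delta)=(\alpha,A\cap r(B,\beta'),\delta\beta')$ whenever the middle set is non-empty, all other products being $0$. Its semilattice of idempotents $E(S)$ consists of $0$ and the elements $(\alpha,A,\alpha)$. A filter in a partially ordered set with least element $0$ is a non-empty, upward closed, downward directed subset not containing $0$; an ultrafilter is a maximal filter. A filter in $E(S)$ is tight if its characteristic function lies in the closure, for pointwise convergence on the space of characters (non-zero maps $E(S)\to\{0,1\}$ preserving $0$ and meets), of the set of characteristic functions of ultrafilters. For a filter $\xi$ in $E(S)$ and a finite or infinite path $\alpha$, let $\xi_n=\{A\in\mathcal B : (\alpha_{1,n},A,\alpha_{1,n})\in\xi\}$, where $\alpha_{1,n}$ is the beginning of $\alpha$ of length $n$. The word $\alpha$ is associated with $\xi$ (written $\xi=\xi^\alpha$) if every $(\beta,A,\beta)\in\xi$ has $\beta$ a beginning of $\alpha$, and $(\xi_n)_{0\le n\le|\alpha|}$ is a complete family for $\alpha$: $\xi_n$ is a filter in $\mathcal B_{\alpha_{1,n}}$ for $n>0$, $\xi_0$ is a filter in $\mathcal B$ or empty, and $\xi_n=\{A\in\mathcal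 B_{\alpha_{1,n}} : r(A,\alpha_{n+1})\in\xi_{n+1}\}$ for $0\le n<|\alpha|$. The filter is of finite type if $|\alpha|<\infty$. A sink is a vertex $v$ with $s^{-1}(v)=\emptyset$. Then for each infinite path $\alpha$ there is a unique tight filter in $E(S)$ whose associated word is $\alpha$. Moreover, a filter $\xi^\alpha$ of finite type is tight if and only if one of the following holds: (i) there is a sink $v$ such that $\xi_{|\alpha|}=\{A\in\mathcal B_\alpha : v\in A\}$; (ii) $\xi_{|\alpha|}$ is an ultrafilter in $\mathcal B_\alpha$, and for every $A\in\xi_{|\alpha|}$ the set $\{e\in\mathcal G^1 : s(e)\in A\}$ is infinite; (iii) $\xi_{|\alpha|}$ is an ultrafilter in $\mathcal B_\alpha$, and every $A\in\xi_{|\alpha|}$ contains infinitely many sinks. -/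

import Mathlib

universe u v w

/-! ### Filters and tight filters in a semilattice with zero -/

/-- A (non-empty) filter in a partially ordered set with least element. -/
def IsPosetFilter {P : Type*} [PartialOrder P] [OrderBot P] (ξ : Set P) : Prop :=
  ξ.Nonempty ∧ ⊥ ∉ ξ ∧ (∀ x ∈ ξ, ∀ y, x ≤ y → y ∈ ξ) ∧
    ∀ x ∈ ξ, ∀ y ∈ ξ, ∃ z ∈ ξ, z ≤ x ∧ z ≤ y

/-- An ultrafilter is a filter which is not properly contained in any filter. -/
def IsPosetUltrafilter {P : Type*} [PartialOrder P] [OrderBot P] (ξ : Set P) : Prop :=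
  IsPosetFilter ξ ∧ ∀ η : Set P, IsPosetFilter η → ξ ⊆ η → ξ = η

/-- The space of characters of a meet semilattice with zero: the non-zero maps to `{0, 1}`
preserving zero and meets, with the topology of pointwise convergence. -/
abbrev SemilatticeCharacter (P : Type*) [SemilatticeInf P] [OrderBot P] : Type _ :=
  {φ : P → Bool // (∃ x, φ x = true) ∧ φ ⊥ = false ∧ ∀ x y, φ (x ⊓ y) = (φ x && φ y)}

/-- The filter corresponding to a character. -/
def SemilatticeCharacter.toFilter {P : Type*} [SemilatticeInf P] [OrderBot P]
    (φ : SemilatticeCharacter P) : Set P :=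
  {x | φ.1 x = true}

/-- The tight spectrum: the closure, in the space of characters, of the set of characters that
correspond to ultrafilters. -/
def tightSpectrum (P : Type*) [SemilatticeInf P] [OrderBot P] : Set (SemilatticeCharacter P) :=
  closure {φ | IsPosetUltrafilter φ.toFilter}

/-- A tight filter is the filter of a tight character. -/
def IsTightFilter {P : Type*} [SemilatticeInf P] [OrderBot P] (ξ : Set P) : Prop :=
  ∃ φ ∈ tightSpectrum P, φ.toFilter = ξ

/-! ### Labelled graphs -/

/-- A labelled graph with vertices `V`, edges `D` and alphabet `L`. -/
structure LabelledGraph (V : Type u) (D : Type v) (L : Type w) where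
  source : D → V
  range : D → V
  label : D → L
  label_surjective : Function.Surjective label

namespace LabelledGraph

variable {V : Type u} {D : Type v} {L : Type w} (Γ : LabelledGraph V D L)

/-- Finite sequences of composable edges. -/
def IsPath (p : List D) : Prop := p.IsChain (fun d d' => Γ.range d = Γ.source d')

/-- The finite labelled paths; this includes the empty word. -/
def IsLabelledPath (α : List L) : Prop := ∃ p : List D, Γ.IsPath p ∧ p.map Γ.label = α

/-- The relative range of a word with respect to a set of vertices, letter by letter. -/
def relRange : Set V → List L → Set V
  | A, [] => A
  | A, a :: α => relRange {x | ∃ d, Γ.label d = a ∧ Γ.source d ∈ A ∧ Γ.range d = x} α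

/-- The range of a word. -/
def wordRange (α : List L) : Set V := Γ.relRange Set.univ α

theorem relRange_append (A : Set V) (α β : List L) :
    Γ.relRange A (α ++ β) = Γ.relRange (Γ.relRange A α) β := by
  induction α generalizing A with
  | nil => rfl
  | cons a α ih => exact ih _

theorem relRange_mono {A B : Set V} (h : A ⊆ B) (α : List L) :
    Γ.relRange A α ⊆ Γ.relRange B α := by
  induction α generalizing A B with
  | nil => exact h
  | cons a α ih => exact ih fun x ⟨d, h1, h2, h3⟩ => ⟨d, h1, h h2, h3⟩

theorem relRange_empty (α : List L) : Γ.relRange ∅ α = ∅ := by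
  induction α with
  | nil => rfl
  | cons a α ih => simpa [relRange] using ih

/-- For a non-empty word the relative range consists of the ranges of the paths with this label
whose source lies in the given set. -/
theorem mem_relRange_cons (A : Set V) (a : L) (α : List L) (x : V) :
    x ∈ Γ.relRange A (a :: α) ↔ ∃ (d : D) (p : List D), Γ.IsPath (d :: p) ∧
      (d :: p).map Γ.label = a :: α ∧ Γ.source d ∈ A ∧
      Γ.range ((d :: p).getLast (List.cons_ne_nil d p)) = x := by
  induction α generalizing A a with
  | nil =>
    constructor
    · rintro ⟨d, h1, h2, h3⟩
      exact ⟨d, [], List.isChain_singleton d, by simp [h1], h2, by simpa using h3⟩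
    · rintro ⟨d, p, -, h2, h3, h4⟩
      simp only [List.map_cons, List.cons.injEq, List.map_eq_nil_iff] at h2
      obtain ⟨h2, rfl⟩ := h2
      exact ⟨d, h2, h3, by simpa using h4⟩
  | cons b α ih =>
    rw [relRange, ih]
    constructor
    · rintro ⟨d, p, h1, h2, ⟨d', h3, h4, h5⟩, h6⟩
      refine ⟨d', d :: p, List.isChain_cons_cons.2 ⟨h5, h1⟩, ?_, h4, ?_⟩
      · rw [List.map_cons, h2, h3]
      · rwa [List.getLast_cons (List.cons_ne_nil d p)]
    · rintro ⟨d, p, h1, h2, h3, h4⟩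
      cases p with
      | nil => simp at h2
      | cons d' p =>
        obtain ⟨h5, h6⟩ := List.isChain_cons_cons.1 h1
        rw [List.map_cons, List.cons.injEq] at h2
        refine ⟨d', p, h6, h2.2, ⟨d, h2.1, h3, h5⟩, ?_⟩
        rwa [List.getLast_cons (List.cons_ne_nil d' p)] at h4

theorem IsLabelledPath.of_relRange_nonempty {A : Set V} {α : List L}
    (h : (Γ.relRange A α).Nonempty) : Γ.IsLabelledPath α := by
  cases α with
  | nil => exact ⟨[], List.isChain_nil, rfl⟩
  | cons a α =>
    obtain ⟨x, hx⟩ := h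
    obtain ⟨d, p, h1, h2, -⟩ := (Γ.mem_relRange_cons A a α x).1 hx
    exact ⟨d :: p, h1, h2⟩

end LabelledGraph

/-! ### Normal labelled spaces -/

/-- A normal labelled space: a labelled graph with a weakly left-resolving family of sets of
vertices, closed under finite unions, finite intersections, relative complements and relative
ranges, and containing the ranges of all labelled paths of positive length. -/
structure NormalLabelledSpace (V : Type u) (D : Type v) (L : Type w)
    extends LabelledGraph V D L where
  family : Set (Set V)
  empty_mem : ∅ ∈ family
  union_mem : ∀ A ∈ family, ∀ B ∈ family, A ∪ B ∈ family
  inter_mem : ∀ A ∈ family, ∀ B ∈ family, A ∩ B ∈ family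
  diff_mem : ∀ A ∈ family, ∀ B ∈ family, A \ B ∈ family
  wordRange_mem : ∀ α, toLabelledGraph.IsLabelledPath α → α ≠ [] →
    toLabelledGraph.wordRange α ∈ family
  relRange_mem : ∀ A ∈ family, ∀ α, toLabelledGraph.IsLabelledPath α →
    toLabelledGraph.relRange A α ∈ family
  relRange_inter : ∀ A ∈ family, ∀ B ∈ family, ∀ α, toLabelledGraph.IsLabelledPath α → α ≠ [] →
    toLabelledGraph.relRange (A ∩ B) α =
      toLabelledGraph.relRange A α ∩ toLabelledGraph.relRange B α

/-- A finite or infinite word. -/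
inductive LWord (L : Type w) where
  | fin (α : List L)
  | inf (α : ℕ → L)

namespace LWord

variable {L : Type w}

/-- The length of a word. -/
def length : LWord L → ℕ∞
  | fin α => (α.length : ℕ∞)
  | inf _ => ⊤

/-- The beginning of length `n` of a word (the word itself if it is shorter). -/
def take : LWord L → ℕ → List L
  | fin α, n => α.take n
  | inf α, n => (List.range n).map α

/-- The letter at position `n`, counted from `0`, if there is one. -/
def letter : LWord L → ℕ → Option L
  | fin α, n => α[n]?
  | inf α, n => some (α n)

end LWord

namespace NormalLabelledSpace

variable {V : Type u} {D : Type v} {L : Type w} (Λ : NormalLabelledSpace V D L)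

/-- The members of the family that are contained in the range of `α`. -/
abbrev FamilyBelow (α : List L) : Type u :=
  {A : Set V // A ∈ Λ.family ∧ A ⊆ Λ.wordRange α}

instance (α : List L) : OrderBot (Λ.FamilyBelow α) where
  bot := ⟨∅, Λ.empty_mem, Set.empty_subset _⟩
  bot_le A := Set.empty_subset A.1

/-- The non-zero elements `(α, A, β)` of the inverse semigroup. -/
@[ext] structure Triple where
  left : List L
  set : Set V
  right : List L
  isLabelledPath_left : Λ.IsLabelledPath left
  isLabelledPath_right : Λ.IsLabelledPath right
  mem_family : set ∈ Λ.family
  subset_left : set ⊆ Λ.wordRange left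
  subset_right : set ⊆ Λ.wordRange right
  nonempty : set.Nonempty

/-- The inverse semigroup of a normal labelled space. -/
inductive InvSemigroup where
  | zero
  | triple (t : Λ.Triple)

/-- The product `(α, A, β)(βγ', B, δ) = (αγ', r(A, γ') ∩ B, δ)`. -/
def Triple.mulOfPrefix (s t : Λ.Triple) (h : s.right <+: t.left)
    (hne : (Λ.relRange s.set (t.left.drop s.right.length) ∩ t.set).Nonempty) : Λ.Triple where
  left := s.left ++ t.left.drop s.right.length
  set := Λ.relRange s.set (t.left.drop s.right.length) ∩ t.set
  right := t.right
  isLabelledPath_left := by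
    refine LabelledGraph.IsLabelledPath.of_relRange_nonempty _ (A := Set.univ) ?_
    rw [LabelledGraph.relRange_append]
    exact (hne.mono Set.inter_subset_left).mono (Λ.relRange_mono s.subset_left _)
  isLabelledPath_right := t.isLabelledPath_right
  mem_family := Λ.inter_mem _ (Λ.relRange_mem _ s.mem_family _
    (LabelledGraph.IsLabelledPath.of_relRange_nonempty _ (hne.mono Set.inter_subset_left)))
    _ t.mem_family
  subset_left := by
    rw [LabelledGraph.wordRange, LabelledGraph.relRange_append]
    exact Set.inter_subset_left.trans (Λ.relRange_mono s.subset_left _)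
  subset_right := Set.inter_subset_right.trans t.subset_right
  nonempty := hne

/-- The involution `(α, A, β)* = (β, A, α)`. -/
def Triple.star (s : Λ.Triple) : Λ.Triple where
  left := s.right
  set := s.set
  right := s.left
  isLabelledPath_left := s.isLabelledPath_right
  isLabelledPath_right := s.isLabelledPath_left
  mem_family := s.mem_family
  subset_left := s.subset_right
  subset_right := s.subset_left
  nonempty := s.nonempty

open Classical in
/-- The product of two non-zero elements. In the second case, with `β = γβ'`, the product
`(α, A, β)(γ, B, δ) = (α, A ∩ r(B, β'), δβ')` is written as the adjoint of the product
`(δ, B, γ)(β, A, α)`. -/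
noncomputable def Triple.mul (s t : Λ.Triple) : Λ.InvSemigroup :=
  if h : s.right <+: t.left ∧
      (Λ.relRange s.set (t.left.drop s.right.length) ∩ t.set).Nonempty then
    .triple (Triple.mulOfPrefix Λ s t h.1 h.2)
  else if h : t.left <+: s.right ∧
      (Λ.relRange t.set (s.right.drop t.left.length) ∩ s.set).Nonempty then
    .triple (Triple.star Λ (Triple.mulOfPrefix Λ (Triple.star Λ t) (Triple.star Λ s) h.1 h.2))
  else .zero

noncomputable instance : Mul Λ.InvSemigroup where
  mul
    | .zero, _ => .zero
    | _, .zero => .zero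
    | .triple s, .triple t => Triple.mul Λ s t

instance : Zero Λ.InvSemigroup := ⟨.zero⟩

/-- The set of idempotents of the inverse semigroup. -/
def Idem : Type _ := {s : Λ.InvSemigroup // s * s = s}

theorem mul_zero' (s : Λ.InvSemigroup) : s * 0 = 0 := by cases s <;> rfl

theorem zero_mul' (s : Λ.InvSemigroup) : 0 * s = 0 := by cases s <;> rfl

theorem mul_prefix {s t : Λ.Triple} (hs : s.left = s.right) (ht : t.left = t.right)
    (h : s.left <+: t.left)
    (hne : (Λ.relRange s.set (t.left.drop s.left.length) ∩ t.set).Nonempty) :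
    ∃ u : Λ.Triple, InvSemigroup.triple s * .triple t = .triple u ∧
      InvSemigroup.triple t * .triple s = .triple u ∧ u.left = t.left ∧ u.right = t.left ∧
      u.set = Λ.relRange s.set (t.left.drop s.left.length) ∩ t.set := by
  obtain ⟨γ, hγ⟩ := h
  have e1 : s.left ++ t.left.drop s.left.length = t.left := by simp [← hγ]
  have c1 : s.right <+: t.left ∧
      (Λ.relRange s.set (t.left.drop s.right.length) ∩ t.set).Nonempty :=
    ⟨hs ▸ ⟨γ, hγ⟩, hs ▸ hne⟩
  refine ⟨Triple.mulOfPrefix Λ s t c1.1 c1.2, dif_pos c1, ?_, ?_, ht.symm, ?_⟩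
  · change Triple.mul Λ t s = _
    have c2 : s.left <+: t.right ∧
        (Λ.relRange s.set (t.right.drop s.left.length) ∩ t.set).Nonempty :=
      ⟨ht ▸ ⟨γ, hγ⟩, ht ▸ hne⟩
    by_cases hts : t.right <+: s.left
    · have e2 : t.left = s.left := by
        rw [← ht] at hts
        exact hts.eq_of_length_le (by rw [← hγ]; simp)
      have c3 : (Λ.relRange t.set (s.left.drop t.right.length) ∩ s.set).Nonempty := by
        have h1 : s.left.drop t.right.length = [] := by simp [← ht, e2]
        have h2 : t.left.drop s.left.length = [] := by simp [e2]
        rw [h2] at hne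
        rw [h1, Set.inter_comm]
        exact hne
      refine (dif_pos ⟨hts, c3⟩).trans (congrArg _ ?_)
      ext1
      · simp [Triple.mulOfPrefix, ← ht, ← hs, e2]
      · simp [Triple.mulOfPrefix, ← ht, ← hs, e2, LabelledGraph.relRange, Set.inter_comm]
      · simp [Triple.mulOfPrefix, ← ht, ← hs, e2]
    · refine (dif_neg fun h => hts h.1).trans ((dif_pos c2).trans (congrArg _ ?_))
      ext1
      · simp [Triple.mulOfPrefix, Triple.star, ← ht, ← hs, e1]
      · simp [Triple.mulOfPrefix, Triple.star, ← ht, ← hs]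
      · simp [Triple.mulOfPrefix, Triple.star, ← ht, ← hs, e1]
  · simp [Triple.mulOfPrefix, ← hs, e1]
  · simp [Triple.mulOfPrefix, ← hs]

theorem mul_eq_zero_of {s t : Λ.Triple} (hs : s.left = s.right) (ht : t.left = t.right)
    (h1 : s.left <+: t.left → ¬ (Λ.relRange s.set (t.left.drop s.left.length) ∩ t.set).Nonempty)
    (h2 : t.left <+: s.left → ¬ (Λ.relRange t.set (s.left.drop t.left.length) ∩ s.set).Nonempty) :
    InvSemigroup.triple s * .triple t = 0 := by
  refine (dif_neg ?_).trans (dif_neg ?_)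
  · rw [← hs]; exact fun h => h1 h.1 h.2
  · rw [← hs]; exact fun h => h2 h.1 h.2

/-- A non-zero element `(α, A, β)` is idempotent if and only if `α = β`. -/
theorem mul_self_iff (t : Λ.Triple) :
    InvSemigroup.triple t * .triple t = .triple t ↔ t.left = t.right := by
  constructor
  · intro h
    change Triple.mul Λ t t = _ at h
    unfold Triple.mul at h
    split_ifs at h with h1 h2
    · have h3 := congrArg Triple.left (InvSemigroup.triple.inj h)
      simp only [Triple.mulOfPrefix, List.append_right_eq_self, List.drop_eq_nil_iff] at h3
      exact (h1.1.eq_of_length_le h3).symm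
    · have h3 := congrArg Triple.right (InvSemigroup.triple.inj h)
      simp only [Triple.mulOfPrefix, Triple.star, List.append_right_eq_self,
        List.drop_eq_nil_iff] at h3
      exact h2.1.eq_of_length_le h3
  · intro h
    have h0 : t.left.drop t.left.length = [] := by simp
    obtain ⟨u, h1, -, h2, h3, h4⟩ := Λ.mul_prefix h h (List.prefix_refl _)
      (by rw [h0]; exact ⟨_, t.nonempty.some_mem, t.nonempty.some_mem⟩)
    rw [h1]
    refine congrArg _ (Triple.ext h2 ?_ (h3.trans h))
    rw [h4, h0]
    exact Set.inter_self _

theorem mul_comm_triple {s t : Λ.Triple} (hs : s.left = s.right) (ht : t.left = t.right) :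
    InvSemigroup.triple s * .triple t = .triple t * .triple s := by
  by_cases h1 : s.left <+: t.left ∧
      (Λ.relRange s.set (t.left.drop s.left.length) ∩ t.set).Nonempty
  · obtain ⟨u, h2, h3, -⟩ := Λ.mul_prefix hs ht h1.1 h1.2
    rw [h2, h3]
  by_cases h1' : t.left <+: s.left ∧
      (Λ.relRange t.set (s.left.drop t.left.length) ∩ s.set).Nonempty
  · obtain ⟨u, h2, h3, -⟩ := Λ.mul_prefix ht hs h1'.1 h1'.2
    rw [h2, h3]
  rw [Λ.mul_eq_zero_of hs ht (fun a b => h1 ⟨a, b⟩) (fun a b => h1' ⟨a, b⟩),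
    Λ.mul_eq_zero_of ht hs (fun a b => h1' ⟨a, b⟩) (fun a b => h1 ⟨a, b⟩)]

theorem triple_ne_zero (t : Λ.Triple) : InvSemigroup.triple t ≠ 0 := by
  intro h; cases h

/-- The order of idempotents: `(α, A, α) ≤ (β, B, β)` if and only if `α = βα'` and
`A ⊆ r(B, α')`. -/
theorem mul_eq_left_iff {s t : Λ.Triple} (hs : s.left = s.right) (ht : t.left = t.right) :
    InvSemigroup.triple s * .triple t = .triple s ↔
      t.left <+: s.left ∧ s.set ⊆ Λ.relRange t.set (s.left.drop t.left.length) := by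
  constructor
  · intro h
    by_cases h1 : t.left <+: s.left ∧
        (Λ.relRange t.set (s.left.drop t.left.length) ∩ s.set).Nonempty
    · obtain ⟨u, -, h3, -, -, h4⟩ := Λ.mul_prefix ht hs h1.1 h1.2
      rw [h] at h3
      rw [← InvSemigroup.triple.inj h3] at h4
      refine ⟨h1.1, fun x hx => ?_⟩
      rw [h4] at hx
      exact hx.1
    by_cases h1' : s.left <+: t.left ∧
        (Λ.relRange s.set (t.left.drop s.left.length) ∩ t.set).Nonempty
    · obtain ⟨u, h2, -, h3, -, h4⟩ := Λ.mul_prefix hs ht h1'.1 h1'.2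
      rw [h] at h2
      rw [← InvSemigroup.triple.inj h2] at h3 h4
      refine absurd ⟨h3 ▸ List.prefix_refl _, ?_⟩ h1
      have h5 : t.left.drop s.left.length = [] := by simp [h3]
      have h6 : s.left.drop t.left.length = [] := by simp [h3]
      rw [h6, Set.inter_comm]
      have := h1'.2
      rw [h5] at this
      exact this
    · rw [Λ.mul_eq_zero_of hs ht (fun a b => h1' ⟨a, b⟩) (fun a b => h1 ⟨a, b⟩)] at h
      exact absurd h.symm (Λ.triple_ne_zero s)
  · rintro ⟨h1, h2⟩
    have h3 := Set.inter_eq_self_of_subset_right h2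
    obtain ⟨u, -, h4, h5, h6, h7⟩ := Λ.mul_prefix ht hs h1 (by rw [h3]; exact s.nonempty)
    rw [h4]
    exact congrArg _ (Triple.ext h5 (h7.trans h3) (h6.trans hs))

theorem mul_idem {s t : Λ.InvSemigroup} (hs : s * s = s) (ht : t * t = t) :
    s * t * (s * t) = s * t := by
  rcases s with _ | s
  · rfl
  rcases t with _ | t
  · rfl
  rw [mul_self_iff] at hs ht
  by_cases h1 : s.left <+: t.left ∧
      (Λ.relRange s.set (t.left.drop s.left.length) ∩ t.set).Nonempty
  · obtain ⟨u, h2, -, h3, h4, -⟩ := Λ.mul_prefix hs ht h1.1 h1.2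
    rw [h2, mul_self_iff, h3, h4]
  by_cases h1' : t.left <+: s.left ∧
      (Λ.relRange t.set (s.left.drop t.left.length) ∩ s.set).Nonempty
  · obtain ⟨u, -, h2, h3, h4, -⟩ := Λ.mul_prefix ht hs h1'.1 h1'.2
    rw [h2, mul_self_iff, h3, h4]
  rw [Λ.mul_eq_zero_of hs ht (fun a b => h1 ⟨a, b⟩) (fun a b => h1' ⟨a, b⟩)]
  rfl

theorem mul_comm_idem {s t : Λ.InvSemigroup} (hs : s * s = s) (ht : t * t = t) :
    s * t = t * s := by
  rcases s with _ | s
  · exact (Λ.mul_zero' t).symm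
  rcases t with _ | t
  · rfl
  exact Λ.mul_comm_triple ((Λ.mul_self_iff s).1 hs) ((Λ.mul_self_iff t).1 ht)

theorem drop_drop_prefix {a b c : List L} (h1 : a <+: b) (h2 : b <+: c) :
    b.drop a.length ++ c.drop b.length = c.drop a.length := by
  obtain ⟨x, rfl⟩ := h1
  obtain ⟨y, rfl⟩ := h2
  simp

theorem mul_eq_left_trans {s t u : Λ.InvSemigroup} (hs : s * s = s) (ht : t * t = t)
    (hu : u * u = u) (h1 : s * t = s) (h2 : t * u = t) : s * u = s := by
  rcases s with _ | s
  · rfl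
  rcases t with _ | t
  · exact absurd ((Λ.mul_zero' _).symm.trans h1).symm (Λ.triple_ne_zero s)
  rcases u with _ | u
  · exact absurd ((Λ.mul_zero' _).symm.trans h2).symm (Λ.triple_ne_zero t)
  rw [mul_self_iff] at hs ht hu
  rw [Λ.mul_eq_left_iff hs ht] at h1
  rw [Λ.mul_eq_left_iff ht hu] at h2
  rw [Λ.mul_eq_left_iff hs hu]
  refine ⟨h2.1.trans h1.1, ?_⟩
  rw [← drop_drop_prefix h2.1 h1.1, LabelledGraph.relRange_append]
  exact h1.2.trans (Λ.relRange_mono h2.2 _)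

theorem mul_mul_right_eq {s t : Λ.InvSemigroup} (hs : s * s = s) (ht : t * t = t) :
    s * t * s = s * t ∧ s * t * t = s * t := by
  rcases s with _ | s
  · exact ⟨rfl, rfl⟩
  rcases t with _ | t
  · exact ⟨rfl, rfl⟩
  have key : ∀ s t : Λ.Triple, s.left = s.right → t.left = t.right → s.left <+: t.left →
      (Λ.relRange s.set (t.left.drop s.left.length) ∩ t.set).Nonempty →
      InvSemigroup.triple s * .triple t * .triple s = .triple s * .triple t ∧
      InvSemigroup.triple s * .triple t * .triple t = .triple s * .triple t := by
    intro s t hs ht h1 h2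
    obtain ⟨u, h3, -, h4, h5, h6⟩ := Λ.mul_prefix hs ht h1 h2
    rw [h3, Λ.mul_eq_left_iff (h4.trans h5.symm) hs, Λ.mul_eq_left_iff (h4.trans h5.symm) ht,
      h4, h6]
    refine ⟨⟨h1, Set.inter_subset_left⟩, List.prefix_refl _, ?_⟩
    rw [List.drop_length]
    exact Set.inter_subset_right
  rw [mul_self_iff] at hs ht
  by_cases h1 : s.left <+: t.left ∧
      (Λ.relRange s.set (t.left.drop s.left.length) ∩ t.set).Nonempty
  · exact key s t hs ht h1.1 h1.2
  by_cases h1' : t.left <+: s.left ∧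
      (Λ.relRange t.set (s.left.drop t.left.length) ∩ s.set).Nonempty
  · rw [Λ.mul_comm_triple hs ht]
    exact (key t s ht hs h1'.1 h1'.2).symm
  rw [Λ.mul_eq_zero_of hs ht (fun a b => h1 ⟨a, b⟩) (fun a b => h1' ⟨a, b⟩)]
  exact ⟨rfl, rfl⟩

theorem le_mul {s t u : Λ.InvSemigroup} (hs : s * s = s) (ht : t * t = t)
    (hu : u * u = u) (h1 : s * t = s) (h2 : s * u = s) : s * (t * u) = s := by
  rcases s with _ | s
  · rfl
  rcases t with _ | t
  · exact absurd ((Λ.mul_zero' _).symm.trans h1).symm (Λ.triple_ne_zero s)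
  rcases u with _ | u
  · exact absurd ((Λ.mul_zero' _).symm.trans h2).symm (Λ.triple_ne_zero s)
  have key : ∀ t u : Λ.Triple, t.left = t.right → u.left = u.right → s.left = s.right →
      t.left <+: u.left →
      InvSemigroup.triple s * .triple t = .triple s →
      InvSemigroup.triple s * .triple u = .triple s →
      InvSemigroup.triple s * (.triple t * .triple u) = .triple s := by
    intro t u ht hu hs h h1 h2
    rw [Λ.mul_eq_left_iff hs ht] at h1
    rw [Λ.mul_eq_left_iff hs hu] at h2
    rw [← drop_drop_prefix h h2.1, LabelledGraph.relRange_append] at h1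
    have hlp : Λ.IsLabelledPath (u.left.drop t.left.length) := by
      refine LabelledGraph.IsLabelledPath.of_relRange_nonempty _ (A := t.set) ?_
      by_contra hn
      have h3 := h1.2
      rw [Set.not_nonempty_iff_eq_empty.1 hn, LabelledGraph.relRange_empty] at h3
      exact (s.nonempty.mono h3).ne_empty rfl
    have hsub : s.set ⊆ Λ.relRange
        (Λ.relRange t.set (u.left.drop t.left.length) ∩ u.set) (s.left.drop u.left.length) := by
      by_cases hnil : s.left.drop u.left.length = []
      · have h3 := h1.2
        have h4 := h2.2
        rw [hnil] at h3 h4 ⊢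
        exact Set.subset_inter h3 h4
      · rw [Λ.relRange_inter _ (Λ.relRange_mem _ t.mem_family _ hlp) _ u.mem_family _
          (LabelledGraph.IsLabelledPath.of_relRange_nonempty _ (s.nonempty.mono h2.2)) hnil]
        exact Set.subset_inter h1.2 h2.2
    have hne : (Λ.relRange t.set (u.left.drop t.left.length) ∩ u.set).Nonempty := by
      by_contra hn
      rw [Set.not_nonempty_iff_eq_empty.1 hn, LabelledGraph.relRange_empty] at hsub
      exact (s.nonempty.mono hsub).ne_empty rfl
    obtain ⟨v, h3, -, h4, h5, h6⟩ := Λ.mul_prefix ht hu h hne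
    rw [h3, Λ.mul_eq_left_iff hs (h4.trans h5.symm), h4, h6]
    exact ⟨h2.1, hsub⟩
  rw [mul_self_iff] at hs ht hu
  have p1 := ((Λ.mul_eq_left_iff hs ht).1 h1).1
  have p2 := ((Λ.mul_eq_left_iff hs hu).1 h2).1
  rcases List.prefix_or_prefix_of_prefix p1 p2 with h | h
  · exact key t u ht hu hs h h1 h2
  · rw [Λ.mul_comm_triple ht hu]
    exact key u t hu ht hs h h2 h1

/-- The idempotents form a meet semilattice: `p ≤ q` means `p * q = p`, and the meet is the
product. -/
noncomputable instance : SemilatticeInf Λ.Idem where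
  le p q := p.1 * q.1 = p.1
  le_refl p := p.2
  le_trans p q r h1 h2 := Λ.mul_eq_left_trans p.2 q.2 r.2 h1 h2
  le_antisymm p q h1 h2 := Subtype.ext (h1.symm.trans ((Λ.mul_comm_idem p.2 q.2).trans h2))
  inf p q := ⟨p.1 * q.1, Λ.mul_idem p.2 q.2⟩
  inf_le_left p q := (Λ.mul_mul_right_eq p.2 q.2).1
  inf_le_right p q := (Λ.mul_mul_right_eq p.2 q.2).2
  le_inf p q r h1 h2 := Λ.le_mul p.2 q.2 r.2 h1 h2

instance : OrderBot Λ.Idem where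
  bot := ⟨0, rfl⟩
  bot_le p := Λ.zero_mul' p.1

/-! ### Complete families and the word of a filter -/

/-- `e` is the idempotent `(α, A, α)`. -/
def Idem.Is {Λ : NormalLabelledSpace V D L} (e : Λ.Idem) (α : List L) (A : Set V) : Prop :=
  ∃ t : Λ.Triple, e.1 = .triple t ∧ t.left = α ∧ t.set = A ∧ t.right = α

/-- The set of all `A` such that `(α, A, α)` belongs to `ξ`. -/
def level (ξ : Set Λ.Idem) (α : List L) : Set (Λ.FamilyBelow α) :=
  {A | ∃ e ∈ ξ, e.Is α A.1}

/-- Complete families for a finite or infinite word `α`; only the indices `n ≤ |α|` matter. -/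
def IsCompleteFamily (α : LWord L) (F : ∀ n, Set (Λ.FamilyBelow (α.take n))) : Prop :=
  (∀ n : ℕ, 0 < n → (n : ℕ∞) ≤ α.length → IsPosetFilter (F n)) ∧
  (IsPosetFilter (F 0) ∨ F 0 = ∅) ∧
  ∀ n a, α.letter n = some a → F n = {A | ∃ B ∈ F (n + 1), B.1 = Λ.relRange A.1 [a]}

/-- `α` is the word associated with the filter `ξ`: all beginnings of `α` are labelled paths, the
sets `ξ_n` form a complete family for `α`, and if `(β, A, β) ∈ ξ` then `β` is a beginning
of `α`. -/
def HasWord (ξ : Set Λ.Idem) (α : LWord L) : Prop :=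
  (∀ n, Λ.IsLabelledPath (α.take n)) ∧
  Λ.IsCompleteFamily α (fun n => Λ.level ξ (α.take n)) ∧
  ∀ e ∈ ξ, ∀ β A, e.Is β A → ∃ n, α.take n = β

end NormalLabelledSpace

/-! ### Ultragraphs -/

/-- An ultragraph with vertex set `V` and edge set `E`. (Countability of `V` and `E` is
required separately.) -/
structure Ultragraph (V : Type u) (E : Type v) where
  source : E → V
  range : E → Set V
  range_nonempty : ∀ e, (range e).Nonempty

namespace Ultragraph

variable {V : Type u} {E : Type v} (G : Ultragraph V E)

/-- The generalized vertices. -/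
inductive IsGenVertex : Set V → Prop
  | singleton (x : V) : IsGenVertex {x}
  | range (e : E) : IsGenVertex (G.range e)
  | empty : IsGenVertex ∅
  | union (A B : Set V) : IsGenVertex A → IsGenVertex B → IsGenVertex (A ∪ B)
  | inter (A B : Set V) : IsGenVertex A → IsGenVertex B → IsGenVertex (A ∩ B)

/-- The accommodating family: the smallest family of sets of vertices containing the generalized
vertices and closed under relative complements, finite unions and finite intersections. -/
inductive IsAccommodating : Set V → Prop
  | of_genVertex (A : Set V) : G.IsGenVertex A → IsAccommodating A
  | diff (A B : Set V) : IsAccommodating A → IsAccommodating B → IsAccommodating (A \ B)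
  | union (A B : Set V) : IsAccommodating A → IsAccommodating B → IsAccommodating (A ∪ B)
  | inter (A B : Set V) : IsAccommodating A → IsAccommodating B → IsAccommodating (A ∩ B)

/-- The labelled graph of an ultragraph: its edges are the pairs `(e, x)` with `x ∈ r(e)`, with
source `s(e)`, range `x` and label `e`. -/
def toLabelledGraph : LabelledGraph V {p : E × V // p.2 ∈ G.range p.1} E where
  source p := G.source p.1.1
  range p := p.1.2
  label p := p.1.1
  label_surjective e := ⟨⟨(e, (G.range_nonempty e).some), (G.range_nonempty e).some_mem⟩, rfl⟩

theorem relRange_cons_of_mem {A : Set V} {e : E} (h : G.source e ∈ A) (α : List E) :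
    G.toLabelledGraph.relRange A (e :: α) = G.toLabelledGraph.relRange (G.range e) α := by
  rw [LabelledGraph.relRange]
  congr 1
  ext x
  constructor
  · rintro ⟨⟨⟨e', y⟩, hp⟩, rfl, -, rfl⟩
    exact hp
  · exact fun hx => ⟨⟨(e, x), hx⟩, rfl, h, rfl⟩

theorem relRange_cons_of_notMem {A : Set V} {e : E} (h : G.source e ∉ A) (α : List E) :
    G.toLabelledGraph.relRange A (e :: α) = ∅ := by
  rw [LabelledGraph.relRange, ← G.toLabelledGraph.relRange_empty α]
  congr 1
  ext x
  simp only [Set.mem_ofPred_eq, Set.mem_empty_iff_false, iff_false]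
  rintro ⟨⟨⟨e', y⟩, hp⟩, rfl, h2, rfl⟩
  exact h h2

theorem isAccommodating_relRange {A : Set V} (hA : G.IsAccommodating A) (α : List E) :
    G.IsAccommodating (G.toLabelledGraph.relRange A α) := by
  induction α generalizing A with
  | nil => exact hA
  | cons e α ih =>
    by_cases h : G.source e ∈ A
    · rw [G.relRange_cons_of_mem h]
      exact ih (.of_genVertex _ (.range e))
    · rw [G.relRange_cons_of_notMem h]
      exact .of_genVertex _ .empty

/-- The normal labelled space of an ultragraph. -/
def toLabelledSpace : NormalLabelledSpace V {p : E × V // p.2 ∈ G.range p.1} E where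
  toLabelledGraph := G.toLabelledGraph
  family := {A | G.IsAccommodating A}
  empty_mem := .of_genVertex _ .empty
  union_mem A hA B hB := .union A B hA hB
  inter_mem A hA B hB := .inter A B hA hB
  diff_mem A hA B hB := .diff A B hA hB
  wordRange_mem α _ hne := by
    cases α with
    | nil => exact absurd rfl hne
    | cons e α =>
      rw [LabelledGraph.wordRange, G.relRange_cons_of_mem (Set.mem_univ _)]
      exact G.isAccommodating_relRange (.of_genVertex _ (.range e)) α
  relRange_mem A hA α _ := G.isAccommodating_relRange hA α
  relRange_inter A _ B _ α _ hne := by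
    cases α with
    | nil => exact absurd rfl hne
    | cons e α =>
      by_cases hA : G.source e ∈ A
      · by_cases hB : G.source e ∈ B
        · rw [G.relRange_cons_of_mem hA, G.relRange_cons_of_mem hB,
            G.relRange_cons_of_mem (Set.mem_inter hA hB), Set.inter_self]
        · rw [G.relRange_cons_of_notMem hB, G.relRange_cons_of_notMem fun h => hB h.2,
            Set.inter_empty]
      · rw [G.relRange_cons_of_notMem hA, G.relRange_cons_of_notMem fun h => hA h.1,
          Set.empty_inter]

/-- Infinite paths of an ultragraph. -/
def IsInfinitePath (α : ℕ → E) : Prop := ∀ n, G.source (α (n + 1)) ∈ G.range (α n)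

/-- The set of sinks. -/
def sinks : Set V := {x | ∀ e, G.source e ≠ x}

/-- The set of edges emitted by a set of vertices. -/
def emitted (A : Set V) : Set E := {e | G.source e ∈ A}

end Ultragraph

/-! ### Filters and tight filters in a semilattice with zero -/

section Semilattice

variable {P : Type*}

/-! Tightness is replaced by a covering criterion, `isTightFilter_iff`: a basic neighbourhood of a
character fixes finitely many values, so `ξ` is tight exactly when, for `x ∈ ξ` and finitely many `y
∉ ξ`, some non-zero `z ≤ x` is disjoint from every `y`. What is special to ultragraphs is that `r(A,
eγ)` depends on `A` only through whether `s(e) ∈ A`. Hence an idempotent that meets one with a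
strictly shorter word lies below it (`le_of_not_disjoint`).

For an infinite path, `r(A, α_{n+1})` is either empty or all of `r(α_{n+1})`, the greatest element
of the next level. Completeness therefore forces `ξ_n` to be the set of all `A` containing
`s(α_{n+1})`. This determines the filter (`eq_pathFilter`), and the filter so described is an
ultrafilter, hence tight.

For finite type, let `ξ` be tight. Splitting `A` into `A ∩ B` and `A \ B` shows that the last level
is prime, hence an ultrafilter. If some `A` in it emits finitely many edges and has finitely many
sinks, the idempotents of these edges and sinks cover `(α, A, α)`. The edges give words longer than
`α`, so one of the sinks belongs to `ξ` (`exists_level_eq_of_finite`). Conversely, a sink gives an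
atom in `ξ`. If the last level is an ultrafilter, shrinking `A` disposes of any finite set outside
`ξ` except for words that continue `α` by one of finitely many letters (`exists_mem_is_disjoint`). A
further edge or a sink avoids these. -/

theorem IsPosetFilter.mem_of_le [PartialOrder P] [OrderBot P] {ξ : Set P} (h : IsPosetFilter ξ)
    {x y : P} (hx : x ∈ ξ) (hxy : x ≤ y) : y ∈ ξ := h.2.2.1 x hx y hxy

theorem IsPosetFilter.ne_bot [PartialOrder P] [OrderBot P] {ξ : Set P} (h : IsPosetFilter ξ)
    {x : P} (hx : x ∈ ξ) : x ≠ ⊥ := fun h' => h.2.1 (h' ▸ hx)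

theorem isPosetFilter_Ici [PartialOrder P] [OrderBot P] {a : P} (ha : a ≠ ⊥) :
    IsPosetFilter (Set.Ici a) :=
  ⟨⟨a, le_rfl⟩, fun h => ha (le_bot_iff.1 h), fun _ hx _ hxy => le_trans hx hxy,
    fun _ hx _ hy => ⟨a, le_rfl, hx, hy⟩⟩

theorem exists_isPosetUltrafilter_mem [PartialOrder P] [OrderBot P] {a : P} (ha : a ≠ ⊥) :
    ∃ η : Set P, IsPosetUltrafilter η ∧ a ∈ η := by
  obtain ⟨η, h1, h2⟩ := zorn_subset_nonempty {η : Set P | IsPosetFilter η} (by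
    intro c hc hchain hne
    refine ⟨⋃₀ c, ⟨?_, ?_, ?_, ?_⟩, fun s hs => Set.subset_sUnion_of_mem hs⟩
    · obtain ⟨s, hs⟩ := hne
      obtain ⟨x, hx⟩ := (hc hs).1
      exact ⟨x, s, hs, hx⟩
    · rintro ⟨s, hs, hx⟩
      exact (hc hs).2.1 hx
    · rintro x ⟨s, hs, hx⟩ y hxy
      exact ⟨s, hs, (hc hs).mem_of_le hx hxy⟩
    · rintro x ⟨s, hs, hx⟩ y ⟨t, ht, hy⟩
      obtain ⟨r, hr, hsr, htr⟩ := hchain.directedOn s hs t ht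
      obtain ⟨z, hz, hzx⟩ := (hc hr).2.2.2 x (hsr hx) y (htr hy)
      exact ⟨z, ⟨r, hr, hz⟩, hzx⟩) _ (isPosetFilter_Ici ha)
  exact ⟨η, ⟨h2.prop, fun ζ hζ hle => h2.eq_of_subset hζ hle⟩, h1 le_rfl⟩

variable [SemilatticeInf P] [OrderBot P]

theorem IsPosetFilter.inf_mem {ξ : Set P} (h : IsPosetFilter ξ) {x y : P} (hx : x ∈ ξ)
    (hy : y ∈ ξ) : x ⊓ y ∈ ξ := by
  obtain ⟨z, hz, h1, h2⟩ := h.2.2.2 x hx y hy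
  exact h.mem_of_le hz (le_inf h1 h2)

theorem IsPosetFilter.not_disjoint {ξ : Set P} (h : IsPosetFilter ξ) {x y : P} (hx : x ∈ ξ)
    (hy : y ∈ ξ) : ¬ Disjoint x y := fun hd =>
  h.ne_bot (h.inf_mem hx hy) hd.eq_bot

/-- If every element of `η` met `y`, the elements above some `z ⊓ y` with `z ∈ η` would form a
filter containing both `η` and `y`. -/
theorem IsPosetUltrafilter.exists_disjoint {η : Set P} (h : IsPosetUltrafilter η) {y : P}
    (hy : y ∉ η) : ∃ z ∈ η, Disjoint z y := by
  by_contra! hn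
  have hf : IsPosetFilter {w | ∃ z ∈ η, z ⊓ y ≤ w} := by
    refine ⟨?_, ?_, ?_, ?_⟩
    · obtain ⟨x, hx⟩ := h.1.1
      exact ⟨x, x, hx, inf_le_left⟩
    · rintro ⟨z, hz, hzy⟩
      exact hn z hz (disjoint_iff.2 (le_bot_iff.1 hzy))
    · rintro x ⟨z, hz, hzx⟩ w hxw
      exact ⟨z, hz, hzx.trans hxw⟩
    · rintro x ⟨z, hz, hzx⟩ x' ⟨z', hz', hzx'⟩
      exact ⟨z ⊓ z' ⊓ y, ⟨z ⊓ z', h.1.inf_mem hz hz', le_rfl⟩,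
        (inf_le_inf_right y inf_le_left).trans hzx, (inf_le_inf_right y inf_le_right).trans hzx'⟩
  obtain ⟨x, hx⟩ := h.1.1
  refine hy ((h.2 _ hf fun z hz => ⟨z, hz, inf_le_left⟩).symm ▸ ⟨x, hx, inf_le_right⟩)

/-! ### Characters and the covering criterion for tightness. -/

theorem SemilatticeCharacter.isPosetFilter (φ : SemilatticeCharacter P) :
    IsPosetFilter φ.toFilter := by
  obtain ⟨φ, h1, h2, h3⟩ := φ
  refine ⟨h1, fun h => ?_, fun x hx y hxy => ?_, fun x hx y hy =>
    ⟨x ⊓ y, ?_, inf_le_left, inf_le_right⟩⟩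
  · exact Bool.false_ne_true (h2.symm.trans h)
  · have := h3 x y
    rw [inf_eq_left.2 hxy] at this
    change φ x = true at hx
    change φ y = true
    simpa [hx] using this
  · change φ x = true at hx
    change φ y = true at hy
    change φ (x ⊓ y) = true
    simp [h3, hx, hy]

theorem IsPosetFilter.exists_toFilter_eq {ξ : Set P} (h : IsPosetFilter ξ) :
    ∃ φ : SemilatticeCharacter P, φ.toFilter = ξ := by
  classical
  refine ⟨⟨fun x => decide (x ∈ ξ), ?_, ?_, fun x y => ?_⟩, ?_⟩
  · obtain ⟨x, hx⟩ := h.1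
    exact ⟨x, decide_eq_true hx⟩
  · simpa using h.2.1
  · rw [← Bool.decide_and]
    refine decide_eq_decide.2 ⟨fun hxy => ⟨h.mem_of_le hxy inf_le_left,
      h.mem_of_le hxy inf_le_right⟩, fun hxy => h.inf_mem hxy.1 hxy.2⟩
  · ext x
    simp [SemilatticeCharacter.toFilter]

theorem IsPosetUltrafilter.exists_disjoint_of_finite {η : Set P} (h : IsPosetUltrafilter η)
    {Y : Set P} (hY : Y.Finite) (hYη : ∀ y ∈ Y, y ∉ η) {x : P} (hx : x ∈ η) :
    ∃ z ∈ η, z ≤ x ∧ ∀ y ∈ Y, Disjoint z y := by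
  induction Y, hY using Set.Finite.induction_on with
  | empty => exact ⟨x, hx, le_rfl, by simp⟩
  | @insert a s _ _ ih =>
    obtain ⟨z, hz, hzx, hd⟩ := ih fun y hy => hYη y (Set.mem_insert_of_mem _ hy)
    obtain ⟨z', hz', hd'⟩ := h.exists_disjoint (hYη a (Set.mem_insert _ _))
    refine ⟨z ⊓ z', h.1.inf_mem hz hz', inf_le_left.trans hzx, ?_⟩
    rintro y (rfl | hy)
    · exact hd'.mono_left inf_le_right
    · exact (hd y hy).mono_left inf_le_left

/-- A filter is tight if and only if no element of it is covered by finitely many elements outside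
the filter. -/
theorem isTightFilter_iff {ξ : Set P} :
    IsTightFilter ξ ↔ IsPosetFilter ξ ∧ ∀ x ∈ ξ, ∀ Y : Set P, Y.Finite → (∀ y ∈ Y, y ∉ ξ) →
      ∃ z, z ≠ ⊥ ∧ z ≤ x ∧ ∀ y ∈ Y, Disjoint z y := by
  classical
  constructor
  · rintro ⟨φ, hφ, rfl⟩
    refine ⟨φ.isPosetFilter, fun x hx Y hY hYξ => ?_⟩
    have hopen : IsOpen {ψ : SemilatticeCharacter P | ψ.1 x = true ∧ ∀ y ∈ Y, ψ.1 y = false} := by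
      have hc : ∀ y : P, Continuous fun ψ : SemilatticeCharacter P => ψ.1 y := fun y =>
        (continuous_apply y).comp continuous_subtype_val
      have he : {ψ : SemilatticeCharacter P | ψ.1 x = true ∧ ∀ y ∈ Y, ψ.1 y = false} =
          (fun ψ : SemilatticeCharacter P => ψ.1 x) ⁻¹' {true} ∩
            ⋂ y ∈ Y, (fun ψ : SemilatticeCharacter P => ψ.1 y) ⁻¹' {false} := by
        ext ψ
        simp
      rw [he]
      exact ((isOpen_discrete _).preimage (hc x)).inter
        (hY.isOpen_biInter fun y _ => (isOpen_discrete _).preimage (hc y))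
    obtain ⟨ψ, ⟨h1, h2⟩, h3⟩ := mem_closure_iff.1 hφ _ hopen
      ⟨hx, fun y hy => Bool.eq_false_iff.2 (hYξ y hy)⟩
    obtain ⟨z, hz, hzx, hd⟩ := IsPosetUltrafilter.exists_disjoint_of_finite h3 hY
      (fun y hy h => Bool.false_ne_true ((h2 y hy).symm.trans h)) h1
    exact ⟨z, h3.1.ne_bot hz, hzx, hd⟩
  · rintro ⟨hf, h⟩
    obtain ⟨φ, rfl⟩ := hf.exists_toFilter_eq
    refine ⟨φ, mem_closure_iff.2 ?_, rfl⟩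
    rintro U hU hφU
    obtain ⟨O, hO, rfl⟩ := isOpen_induced_iff.1 hU
    -- Only the finitely many coordinates in `I` are constrained. Those in the filter are condensed
    -- into one element `x` below all of them; the others serve as the finite set to be avoided.
    obtain ⟨I, u, hu, hIu⟩ := isOpen_pi_iff.1 hO _ hφU
    obtain ⟨x, hx, hxI⟩ : ∃ x ∈ φ.toFilter, ∀ i ∈ I, i ∈ φ.toFilter → x ≤ i := by
      clear hu hIu
      induction I using Finset.induction_on with
      | empty =>
        obtain ⟨x, hx⟩ := hf.1
        exact ⟨x, hx, by simp⟩
      | insert a s _ ih =>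
        obtain ⟨x, hx, hxs⟩ := ih
        by_cases ha : a ∈ φ.toFilter
        · refine ⟨x ⊓ a, hf.inf_mem hx ha, fun i hi hiφ => ?_⟩
          rcases Finset.mem_insert.1 hi with rfl | hi
          · exact inf_le_right
          · exact inf_le_left.trans (hxs i hi hiφ)
        · refine ⟨x, hx, fun i hi hiφ => ?_⟩
          rcases Finset.mem_insert.1 hi with rfl | hi
          · exact absurd hiφ ha
          · exact hxs i hi hiφ
    obtain ⟨z, hz, hzx, hd⟩ := h x hx {i | i ∈ I ∧ i ∉ φ.toFilter}
      (I.finite_toSet.subset fun i hi => hi.1) fun y hy => hy.2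
    -- Any ultrafilter through `z` agrees with `φ` on `I`: it contains everything above `z`, and
    -- nothing disjoint from `z`.
    obtain ⟨η, hη, hzη⟩ := exists_isPosetUltrafilter_mem hz
    obtain ⟨ψ, rfl⟩ := hη.1.exists_toFilter_eq
    refine ⟨ψ, hIu fun i hi => ?_, hη⟩
    have heq : ψ.1 i = φ.1 i := by
      by_cases hiφ : i ∈ φ.toFilter
      · exact (hη.1.mem_of_le hzη (hzx.trans (hxI i hi hiφ)) : ψ.1 i = true).trans hiφ.symm
      · have hiψ : i ∉ ψ.toFilter := fun hiψ => hη.1.not_disjoint hzη hiψ (hd i ⟨hi, hiφ⟩)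
        exact (Bool.eq_false_iff.2 hiψ).trans (Bool.eq_false_iff.2 hiφ).symm
    exact heq ▸ (hu i hi).2

theorem IsPosetUltrafilter.isTightFilter {ξ : Set P} (h : IsPosetUltrafilter ξ) :
    IsTightFilter ξ :=
  isTightFilter_iff.2 ⟨h.1, fun _ hx _ hY hYξ =>
    let ⟨z, hz, hzx, hd⟩ := h.exists_disjoint_of_finite hY hYξ hx
    ⟨z, h.1.ne_bot hz, hzx, hd⟩⟩

/-- An atom is either below a given element or disjoint from it, so `a` itself avoids everything
outside the filter. -/
theorem IsPosetFilter.isTightFilter_of_isAtom_mem {ξ : Set P} (h : IsPosetFilter ξ) {a : P}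
    (ha : IsAtom a) (haξ : a ∈ ξ) : IsTightFilter ξ :=
  isTightFilter_iff.2 ⟨h, fun _ hx _ _ hYξ => ⟨a, ha.1,
    not_not.1 fun hn => h.not_disjoint haξ hx (ha.not_le_iff_disjoint.1 hn),
    fun y hy => ha.not_le_iff_disjoint.1 fun hay => hYξ y hy (h.mem_of_le haξ hay)⟩⟩

end Semilattice

/-! ### Idempotents -/

namespace NormalLabelledSpace

variable {V : Type u} {D : Type v} {L : Type w} {Λ : NormalLabelledSpace V D L}

theorem Idem.Is.nonempty {e : Λ.Idem} {α : List L} {A : Set V} (h : e.Is α A) : A.Nonempty := by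
  obtain ⟨t, -, -, rfl, -⟩ := h
  exact t.nonempty

theorem Idem.Is.mem_family {e : Λ.Idem} {α : List L} {A : Set V} (h : e.Is α A) :
    A ∈ Λ.family := by
  obtain ⟨t, -, -, rfl, -⟩ := h
  exact t.mem_family

theorem Idem.Is.subset_wordRange {e : Λ.Idem} {α : List L} {A : Set V} (h : e.Is α A) :
    A ⊆ Λ.wordRange α := by
  obtain ⟨t, -, rfl, rfl, -⟩ := h
  exact t.subset_left

theorem Idem.Is.ne_bot {e : Λ.Idem} {α : List L} {A : Set V} (h : e.Is α A) : e ≠ ⊥ := by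
  rintro rfl
  obtain ⟨t, h, -⟩ := h
  exact Λ.triple_ne_zero t h.symm

theorem Idem.exists_is {e : Λ.Idem} (h : e ≠ ⊥) : ∃ α A, e.Is α A := by
  obtain ⟨e | t, he⟩ := e
  · exact absurd rfl h
  · exact ⟨t.left, t.set, t, rfl, rfl, rfl, ((Λ.mul_self_iff t).1 he).symm⟩

theorem Idem.Is.le_iff {e f : Λ.Idem} {α β : List L} {A B : Set V} (he : e.Is α A)
    (hf : f.Is β B) : e ≤ f ↔ β <+: α ∧ A ⊆ Λ.relRange B (α.drop β.length) := by
  obtain ⟨s, hs, rfl, rfl, hs'⟩ := he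
  obtain ⟨t, ht, rfl, rfl, ht'⟩ := hf
  change e.1 * f.1 = e.1 ↔ _
  rw [hs, ht]
  exact Λ.mul_eq_left_iff hs'.symm ht'.symm

theorem Idem.Is.le_iff_subset {e f : Λ.Idem} {α : List L} {A B : Set V} (he : e.Is α A)
    (hf : f.Is α B) : e ≤ f ↔ A ⊆ B := by
  rw [he.le_iff hf, List.drop_length]
  exact ⟨fun h => h.2, fun h => ⟨List.prefix_refl _, h⟩⟩

theorem Idem.Is.unique {e : Λ.Idem} {α β : List L} {A B : Set V} (he : e.Is α A)
    (hf : e.Is β B) : α = β ∧ A = B := by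
  obtain ⟨s, hs, rfl, rfl, -⟩ := he
  obtain ⟨t, ht, rfl, rfl, -⟩ := hf
  cases hs.symm.trans ht
  exact ⟨rfl, rfl⟩

theorem Idem.Is.eq {e f : Λ.Idem} {α : List L} {A : Set V} (he : e.Is α A) (hf : f.Is α A) :
    e = f :=
  le_antisymm ((he.le_iff_subset hf).2 le_rfl) ((hf.le_iff_subset he).2 le_rfl)

theorem exists_idem_is {α : List L} {A : Set V} (hA : A ∈ Λ.family)
    (hAα : A ⊆ Λ.wordRange α) (hne : A.Nonempty) : ∃ e : Λ.Idem, e.Is α A :=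
  have hα : Λ.IsLabelledPath α := .of_relRange_nonempty _ (hne.mono hAα)
  let t : Λ.Triple := ⟨α, A, α, hα, hα, hA, hAα, hAα, hne⟩
  ⟨⟨.triple t, (Λ.mul_self_iff t).2 rfl⟩, t, rfl, rfl, rfl, rfl⟩

/-- Working with this set allows the idempotent to be put in a finite cover without checking that it
exists: for empty `A` the set is empty. -/
theorem finite_setOf_is (α : List L) (A : Set V) : {e : Λ.Idem | e.Is α A}.Finite :=
  Set.Subsingleton.finite fun _ he _ hf => Idem.Is.eq he hf

theorem mem_level_iff {ξ : Set Λ.Idem} {e : Λ.Idem} {α : List L} {A : Λ.FamilyBelow α}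
    (he : e.Is α A.1) : A ∈ Λ.level ξ α ↔ e ∈ ξ :=
  ⟨fun ⟨_, hf, hfA⟩ => he.eq hfA ▸ hf, fun h => ⟨e, h, he⟩⟩

instance instSemilatticeInfFamilyBelow (α : List L) : SemilatticeInf (Λ.FamilyBelow α) where
  inf A B := ⟨A.1 ∩ B.1, Λ.inter_mem _ A.2.1 _ B.2.1, Set.inter_subset_left.trans A.2.2⟩
  inf_le_left A B := (Set.inter_subset_left : A.1 ∩ B.1 ⊆ A.1)
  inf_le_right A B := (Set.inter_subset_right : A.1 ∩ B.1 ⊆ B.1)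
  le_inf A B C h1 h2 := (Set.subset_inter h1 h2 : A.1 ⊆ B.1 ∩ C.1)

theorem familyBelow_ne_bot_iff {α : List L} {A : Λ.FamilyBelow α} : A ≠ ⊥ ↔ A.1.Nonempty := by
  rw [Set.nonempty_iff_ne_empty, not_iff_not]
  exact ⟨fun h => congrArg Subtype.val h, fun h => Subtype.ext h⟩

end NormalLabelledSpace

/-! ### Ultragraphs -/

namespace Ultragraph

open NormalLabelledSpace

variable {V : Type u} {E : Type v} {G : Ultragraph V E}

theorem source_mem_of_relRange_nonempty {A : Set V} {e : E} {α : List E}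
    (h : (G.toLabelledSpace.relRange A (e :: α)).Nonempty) : G.source e ∈ A := by
  by_contra hn
  exact h.ne_empty (G.relRange_cons_of_notMem hn α)

/-- The feature of ultragraphs used throughout: along a non-empty word the relative range is all or
nothing, decided by the source of the first letter. -/
theorem relRange_cons_eq {A B : Set V} {e : E} (hA : G.source e ∈ A) (hB : G.source e ∈ B)
    (α : List E) :
    G.toLabelledSpace.relRange A (e :: α) = G.toLabelledSpace.relRange B (e :: α) :=
  (G.relRange_cons_of_mem hA α).trans (G.relRange_cons_of_mem hB α).symm

theorem relRange_singleton {A : Set V} {e : E} (hA : G.source e ∈ A) :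
    G.toLabelledSpace.relRange A [e] = G.range e :=
  G.relRange_cons_of_mem hA []

theorem singleton_mem_family (x : V) : {x} ∈ G.toLabelledSpace.family :=
  .of_genVertex _ (.singleton x)

theorem range_mem_family (e : E) : G.range e ∈ G.toLabelledSpace.family :=
  .of_genVertex _ (.range e)

/-! ### Comparison and disjointness of idempotents. -/

theorem wordRange_append (α β : List E) : G.toLabelledSpace.wordRange (α ++ β) =
    G.toLabelledSpace.relRange (G.toLabelledSpace.wordRange α) β :=
  G.toLabelledGraph.relRange_append _ _ _

/-- Two idempotents meet if the set of the longer one meets the relative range of the shorter. -/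
theorem not_disjoint_of_nonempty {z y : G.toLabelledSpace.Idem} {γ β : List E} {C B : Set V}
    (hz : z.Is γ C) (hy : y.Is β B) (hβ : β <+: γ)
    (hne : (C ∩ G.toLabelledSpace.relRange B (γ.drop β.length)).Nonempty) : ¬ Disjoint z y := by
  obtain ⟨c, hc, hcB⟩ := hne
  -- Singletons belong to the family, so one common point already yields a non-zero lower bound.
  obtain ⟨w, hw⟩ := exists_idem_is (singleton_mem_family c)
    (Set.singleton_subset_iff.2 (hz.subset_wordRange hc)) (Set.singleton_nonempty c)
  intro hd
  exact hw.ne_bot (le_bot_iff.1 (hd ((hw.le_iff_subset hz).2 (Set.singleton_subset_iff.2 hc))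
    ((hw.le_iff hy).2 ⟨hβ, Set.singleton_subset_iff.2 hcB⟩)))

/-- The word `δ` is that of the non-zero meet `x ⊓ y`. -/
theorem exists_common_extension {x y : G.toLabelledSpace.Idem} {α β : List E} {A B : Set V}
    (hx : x.Is α A) (hy : y.Is β B) (hd : ¬ Disjoint x y) :
    ∃ δ, α <+: δ ∧ β <+: δ ∧ (G.toLabelledSpace.relRange A (δ.drop α.length) ∩
      G.toLabelledSpace.relRange B (δ.drop β.length)).Nonempty := by
  obtain ⟨δ, C, hw⟩ := Idem.exists_is fun h => hd (disjoint_iff.2 h)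
  have h1 := (hw.le_iff hx).1 inf_le_left
  have h2 := (hw.le_iff hy).1 inf_le_right
  exact ⟨δ, h1.1, h2.1, hw.nonempty.mono (Set.subset_inter h1.2 h2.2)⟩

theorem source_mem_of_not_disjoint {x y : G.toLabelledSpace.Idem} {β γ : List E} {e : E}
    {A B : Set V} (hx : x.Is (β ++ e :: γ) A) (hy : y.Is β B) (hd : ¬ Disjoint x y) :
    G.source e ∈ B := by
  obtain ⟨δ, ⟨δ', rfl⟩, -, hne⟩ := exists_common_extension hx hy hd
  refine source_mem_of_relRange_nonempty (α := γ ++ δ') ((hne.mono Set.inter_subset_right).mono ?_)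
  simp

/-- If an idempotent meets one with a strictly shorter word, then it lies below it. -/
theorem le_of_not_disjoint {x y : G.toLabelledSpace.Idem} {β γ : List E} {e : E}
    {A B : Set V} (hx : x.Is (β ++ e :: γ) A) (hy : y.Is β B) (hd : ¬ Disjoint x y) : x ≤ y := by
  have h := hx.subset_wordRange
  -- Since `s(e)` lies in both `r(β)` and `B`, the set `B` may replace `r(β)` in `A ⊆ r(βeγ) =
  -- r(r(β), eγ)`.
  rw [wordRange_append, relRange_cons_eq
    (source_mem_of_relRange_nonempty (wordRange_append (G := G) _ _ ▸
      hx.nonempty.mono hx.subset_wordRange))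
    (source_mem_of_not_disjoint hx hy hd)] at h
  refine (hx.le_iff hy).2 ⟨List.prefix_append _ _, ?_⟩
  rwa [List.drop_left]

/-! ### Idempotents of single edges and single vertices. -/

theorem exists_is_range {α : List E} {e : E}
    (he : G.source e ∈ G.toLabelledSpace.wordRange α) :
    ∃ z : G.toLabelledSpace.Idem, z.Is (α ++ [e]) (G.range e) :=
  exists_idem_is (range_mem_family e)
    (by rw [wordRange_append, relRange_singleton he]) (G.range_nonempty e)

theorem exists_is_singleton {α : List E} {x : V} (hx : x ∈ G.toLabelledSpace.wordRange α) :
    ∃ z : G.toLabelledSpace.Idem, z.Is α {x} :=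
  exists_idem_is (singleton_mem_family x) (Set.singleton_subset_iff.2 hx)
    (Set.singleton_nonempty x)

theorem le_of_source_mem {α : List E} {e : E} {A : Set V} {z x : G.toLabelledSpace.Idem}
    (hz : z.Is (α ++ [e]) (G.range e)) (hx : x.Is α A) (he : G.source e ∈ A) : z ≤ x := by
  refine (hz.le_iff hx).2 ⟨List.prefix_append _ _, ?_⟩
  rw [List.drop_left, relRange_singleton he]

theorem disjoint_of_sink {α β : List E} {e : E} {B : Set V} {v : V} (hv : v ∈ G.sinks)
    {z y : G.toLabelledSpace.Idem} (hz : z.Is α {v}) (hy : y.Is β B) (hβ : α ++ [e] <+: β) :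
    Disjoint z y := by
  obtain ⟨γ, rfl⟩ := hβ
  by_contra hd
  rw [disjoint_comm] at hd
  exact hv e (source_mem_of_not_disjoint (γ := γ) (by simpa using hy) hz hd)

/-- The idempotents of sinks are minimal. -/
theorem isAtom_of_sink {α : List E} {v : V} (hv : v ∈ G.sinks)
    {z : G.toLabelledSpace.Idem} (hz : z.Is α {v}) : IsAtom z := by
  refine ⟨hz.ne_bot, fun w hwz => ?_⟩
  by_contra hw
  obtain ⟨β, B, hB⟩ := Idem.exists_is hw
  obtain ⟨⟨γ, rfl⟩, h⟩ := (hB.le_iff hz).1 hwz.le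
  rcases γ with _ | ⟨e, γ⟩
  · simp only [List.append_nil, List.drop_length] at h hB
    have : B = {v} := (Set.subset_singleton_iff_eq.1 h).resolve_left hB.nonempty.ne_empty
    exact hwz.ne (hB.eq (this ▸ hz))
  · rw [List.drop_left] at h
    exact hv e (source_mem_of_relRange_nonempty (hB.nonempty.mono h))

/-! ### Infinite paths -/

theorem IsInfinitePath.source_mem_relRange {α : ℕ → E} (hα : G.IsInfinitePath α) (k : ℕ) {n : ℕ}
    {A : Set V} (hA : G.source (α n) ∈ A) :
    G.source (α (n + k)) ∈ G.toLabelledSpace.relRange A ((List.range' n k).map α) := by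
  induction k generalizing n A with
  | zero => exact hA
  | succ k ih =>
    rw [List.range'_succ, List.map_cons]
    have := ih (hα n)
    rw [Nat.add_right_comm] at this
    exact (G.relRange_cons_of_mem hA _).symm ▸ this

theorem drop_take_inf (α : ℕ → E) (n k : ℕ) :
    ((LWord.inf α).take (n + k)).drop n = (List.range' n k).map α := by
  simp [LWord.take, List.range_eq_range', ← List.map_drop]

theorem take_inf_length (α : ℕ → E) (n : ℕ) : ((LWord.inf α).take n).length = n := by
  simp [LWord.take]

theorem take_inf_add (α : ℕ → E) (n k : ℕ) : (LWord.inf α).take (n + k) =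
    (LWord.inf α).take n ++ (List.range' n k).map α := by
  rw [← drop_take_inf]
  have : (LWord.inf α).take n = ((LWord.inf α).take (n + k)).take n := by
    simp [LWord.take, ← List.map_take, List.take_range]
  rw [this, List.take_append_drop]

theorem IsInfinitePath.source_mem_wordRange {α : ℕ → E} (hα : G.IsInfinitePath α) (n : ℕ) :
    G.source (α n) ∈ G.toLabelledSpace.wordRange ((LWord.inf α).take n) := by
  have := hα.source_mem_relRange n (n := 0) (Set.mem_univ _)
  rw [Nat.zero_add] at this
  simpa [LabelledGraph.wordRange, LWord.take, List.range_eq_range'] using this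

theorem IsInfinitePath.isLabelledPath {α : ℕ → E} (hα : G.IsInfinitePath α) (n : ℕ) :
    G.toLabelledSpace.IsLabelledPath ((LWord.inf α).take n) :=
  .of_relRange_nonempty _ ⟨_, hα.source_mem_wordRange n⟩

/-- The filter of an infinite path. -/
def pathFilter (G : Ultragraph V E) (α : ℕ → E) : Set G.toLabelledSpace.Idem :=
  {e | ∃ n A, e.Is ((LWord.inf α).take n) A ∧ G.source (α n) ∈ A}

theorem mem_pathFilter_iff {α : ℕ → E} {n : ℕ} {A : Set V} {e : G.toLabelledSpace.Idem}
    (he : e.Is ((LWord.inf α).take n) A) : e ∈ G.pathFilter α ↔ G.source (α n) ∈ A := by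
  refine ⟨?_, fun h => ⟨n, A, he, h⟩⟩
  rintro ⟨m, B, hB, h⟩
  obtain ⟨h1, rfl⟩ := he.unique hB
  have := congrArg List.length h1
  rw [take_inf_length, take_inf_length] at this
  exact this ▸ h

theorem IsInfinitePath.le_of_mem {α : ℕ → E} (hα : G.IsInfinitePath α) {n k : ℕ} {A : Set V}
    {e z : G.toLabelledSpace.Idem} (he : e.Is ((LWord.inf α).take n) A)
    (hA : G.source (α n) ∈ A)
    (hz : z.Is ((LWord.inf α).take (n + k)) {G.source (α (n + k))}) : z ≤ e := by
  refine (hz.le_iff he).2 ⟨take_inf_add α n k ▸ List.prefix_append _ _, ?_⟩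
  rw [take_inf_length, drop_take_inf, Set.singleton_subset_iff]
  exact hα.source_mem_relRange k hA

/-- Both words begin a common word, so `β` is a beginning of `α`. As `β` is strictly shorter than
`n`, the letter of `α` after `β` occurs in the word of `z`, and meeting `y` forces its source into
`B`. Upward closure and maximality of the path filter both rest on this. -/
theorem mem_pathFilter_of_not_disjoint {α : ℕ → E} {n : ℕ} {B C : Set V}
    {y z : G.toLabelledSpace.Idem} {β : List E} (hz : z.Is ((LWord.inf α).take n) C)
    (hy : y.Is β B) (hβ : β.length < n) (hd : ¬ Disjoint z y) : y ∈ G.pathFilter α := by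
  obtain ⟨k, rfl⟩ := Nat.exists_eq_add_of_lt hβ
  obtain ⟨δ, h1, h2, -⟩ := exists_common_extension hz hy hd
  rw [Nat.add_assoc, take_inf_add] at hz h1
  have hβ' : β = (LWord.inf α).take β.length :=
    (List.prefix_of_prefix_length_le h2 ((List.prefix_append _ _).trans h1)
      (by rw [take_inf_length])).eq_of_length (by rw [take_inf_length])
  rw [List.range'_succ, List.map_cons, ← hβ'] at hz
  exact ⟨β.length, B, hβ' ▸ hy, source_mem_of_not_disjoint hz hy hd⟩

theorem IsInfinitePath.isPosetFilter {α : ℕ → E} (hα : G.IsInfinitePath α) :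
    IsPosetFilter (G.pathFilter α) := by
  refine ⟨?_, ?_, ?_, ?_⟩
  · obtain ⟨z, hz⟩ := exists_is_singleton (hα.source_mem_wordRange 0)
    exact ⟨z, 0, _, hz, rfl⟩
  · rintro ⟨n, A, hA, -⟩
    exact hA.ne_bot rfl
  · rintro x ⟨n, A, hx, hA⟩ y hxy
    have hy0 : y ≠ ⊥ := fun h => hx.ne_bot (le_bot_iff.1 (h ▸ hxy))
    obtain ⟨β, B, hy⟩ := Idem.exists_is hy0
    have hl := ((hx.le_iff hy).1 hxy).1.length_le
    rw [take_inf_length] at hl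
    -- One level beyond `n`, so that the word of `y` is strictly shorter than that of `z`.
    obtain ⟨z, hz⟩ := exists_is_singleton (hα.source_mem_wordRange (n + 1))
    have hzy : z ≤ y := (hα.le_of_mem hx hA hz).trans hxy
    exact mem_pathFilter_of_not_disjoint hz hy (Nat.lt_succ_of_le hl)
      fun hd => hz.ne_bot (le_bot_iff.1 (hd le_rfl hzy))
  · rintro x ⟨n, A, hx, hA⟩ y ⟨m, B, hy, hB⟩
    obtain ⟨z, hz⟩ := exists_is_singleton (hα.source_mem_wordRange (n + m))
    exact ⟨z, ⟨_, _, hz, rfl⟩, hα.le_of_mem hx hA hz,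
      hα.le_of_mem (k := n) hy hB (by rwa [Nat.add_comm m n])⟩

theorem IsInfinitePath.isPosetUltrafilter {α : ℕ → E} (hα : G.IsInfinitePath α) :
    IsPosetUltrafilter (G.pathFilter α) := by
  refine ⟨hα.isPosetFilter, fun η hη hle => hle.antisymm fun y hy => ?_⟩
  obtain ⟨β, B, hB⟩ := Idem.exists_is (hη.ne_bot hy)
  -- The larger filter `η` contains the vertex idempotent one level beyond `y`, so `y` must meet it.
  obtain ⟨z, hz⟩ := exists_is_singleton (hα.source_mem_wordRange (β.length + 1))
  exact mem_pathFilter_of_not_disjoint hz hB (Nat.lt_succ_self _)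
    (hη.not_disjoint (hle ⟨_, _, hz, rfl⟩) hy)

theorem level_pathFilter (α : ℕ → E) (n : ℕ) :
    G.toLabelledSpace.level (G.pathFilter α) ((LWord.inf α).take n) =
      {A | G.source (α n) ∈ A.1} := by
  ext A
  constructor
  · rintro ⟨e, he, heA⟩
    exact (mem_pathFilter_iff heA).1 he
  · intro hA
    obtain ⟨e, he⟩ := exists_idem_is A.2.1 A.2.2 ⟨_, hA⟩
    exact ⟨e, ⟨_, _, he, hA⟩, he⟩

theorem IsInfinitePath.isPosetFilter_level {α : ℕ → E} (hα : G.IsInfinitePath α) (n : ℕ) :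
    IsPosetFilter (G.toLabelledSpace.level (G.pathFilter α) ((LWord.inf α).take n)) := by
  let a : G.toLabelledSpace.FamilyBelow ((LWord.inf α).take n) :=
    ⟨{G.source (α n)}, singleton_mem_family _,
      Set.singleton_subset_iff.2 (hα.source_mem_wordRange n)⟩
  have ha : a ≠ ⊥ := familyBelow_ne_bot_iff.2 (Set.singleton_nonempty _)
  convert isPosetFilter_Ici ha
  rw [level_pathFilter]
  ext A
  exact (Set.singleton_subset_iff (a := G.source (α n)) (s := A.1)).symm

theorem IsInfinitePath.hasWord {α : ℕ → E} (hα : G.IsInfinitePath α) :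
    G.toLabelledSpace.HasWord (G.pathFilter α) (.inf α) := by
  refine ⟨hα.isLabelledPath, ⟨fun n _ _ => hα.isPosetFilter_level n,
    .inl (hα.isPosetFilter_level 0), ?_⟩, ?_⟩
  · rintro n a ha
    obtain rfl : α n = a := Option.some.inj ha
    simp only [level_pathFilter]
    ext A
    constructor
    · intro hA
      have hA' : G.source (α n) ∈ A.1 := hA
      have hw := hα.source_mem_wordRange n
      have htake : (LWord.inf α).take (n + 1) = (LWord.inf α).take n ++ [α n] :=
        take_inf_add α n 1
      refine ⟨⟨G.range (α n), range_mem_family _, ?_⟩, hα n, (relRange_singleton hA').symm⟩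
      rw [htake, wordRange_append, relRange_singleton hw]
    · rintro ⟨B, hB, hBA⟩
      exact source_mem_of_relRange_nonempty (α := []) (hBA ▸ ⟨_, hB⟩)
  · rintro e ⟨n, A, hA, -⟩ β B hB
    exact ⟨n, (hA.unique hB).1⟩

/-- By completeness, `A` is in level `n` if and only if its relative range is in level `n + 1`. That
range is empty, which a filter excludes, or the whole range of the letter, which every filter at
level `n + 1` contains. -/
theorem mem_level_iff_source_mem {ξ : Set G.toLabelledSpace.Idem} {α : ℕ → E}
    (h : G.toLabelledSpace.HasWord ξ (.inf α)) {n : ℕ}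
    (A : G.toLabelledSpace.FamilyBelow ((LWord.inf α).take n)) :
    A ∈ G.toLabelledSpace.level ξ ((LWord.inf α).take n) ↔ G.source (α n) ∈ A.1 := by
  have hf := h.2.1.1 (n + 1) n.succ_pos le_top
  have hl := h.2.1.2.2 n (α n) rfl
  have htake : (LWord.inf α).take (n + 1) = (LWord.inf α).take n ++ [α n] :=
    take_inf_add α n 1
  beta_reduce at hf hl
  rw [hl]
  constructor
  · rintro ⟨B, hB, hBA⟩
    exact source_mem_of_relRange_nonempty (α := [])
      (hBA ▸ familyBelow_ne_bot_iff.1 (hf.ne_bot hB))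
  · intro hA
    have hw : G.toLabelledSpace.wordRange ((LWord.inf α).take (n + 1)) = G.range (α n) := by
      rw [htake, wordRange_append, relRange_singleton (A.2.2 hA)]
    obtain ⟨B, hB⟩ := hf.1
    have hle : B ≤ (⟨G.range (α n), range_mem_family _, hw.ge⟩ :
        G.toLabelledSpace.FamilyBelow ((LWord.inf α).take (n + 1))) := by
      have := B.2.2.trans hw.le
      exact this
    exact ⟨_, hf.mem_of_le hB hle, (relRange_singleton hA).symm⟩

theorem eq_pathFilter {ξ : Set G.toLabelledSpace.Idem} {α : ℕ → E} (hξ : IsPosetFilter ξ)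
    (h : G.toLabelledSpace.HasWord ξ (.inf α)) : ξ = G.pathFilter α := by
  ext e
  constructor
  · intro he
    obtain ⟨β, A, hA⟩ := Idem.exists_is (hξ.ne_bot he)
    obtain ⟨n, rfl⟩ := h.2.2 e he β A hA
    exact ⟨n, A, hA, (mem_level_iff_source_mem h ⟨A, hA.mem_family, hA.subset_wordRange⟩).1
      ⟨e, he, hA⟩⟩
  · rintro ⟨n, A, hA, hs⟩
    exact (mem_level_iff (A := ⟨A, hA.mem_family, hA.subset_wordRange⟩) hA).1
      ((mem_level_iff_source_mem h _).2 hs)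

/-! ### Filters of finite type -/

theorem isPosetFilter_level {ξ : Set G.toLabelledSpace.Idem} {α : List E} (hξ : IsPosetFilter ξ)
    (h : G.toLabelledSpace.HasWord ξ (.fin α)) : IsPosetFilter (G.toLabelledSpace.level ξ α) := by
  rcases α with _ | ⟨e, α⟩
  · refine h.2.1.2.1.resolve_right fun h0 => ?_
    obtain ⟨x, hx⟩ := hξ.1
    obtain ⟨β, A, hA⟩ := Idem.exists_is (hξ.ne_bot hx)
    obtain ⟨n, rfl⟩ := h.2.2 x hx β A hA
    change G.toLabelledSpace.level ξ [] = ∅ at h0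
    simp only [LWord.take, List.take_nil] at hA
    have hmem : (⟨A, hA.mem_family, hA.subset_wordRange⟩ :
        G.toLabelledSpace.FamilyBelow []) ∈ G.toLabelledSpace.level ξ [] := ⟨x, hx, hA⟩
    rw [h0] at hmem
    exact hmem
  · have hf := h.2.1.1 (e :: α).length (by simp) le_rfl
    have ht : (LWord.fin (e :: α)).take (e :: α).length = e :: α := List.take_length
    beta_reduce at hf
    rwa [ht] at hf

/-- An element of `ξ` below both `x` and some element with word `α` has a word that extends `α` and
is also a beginning of `α`. -/
theorem exists_mem_is_le {ξ : Set G.toLabelledSpace.Idem} {α : List E} (hξ : IsPosetFilter ξ)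
    (h : G.toLabelledSpace.HasWord ξ (.fin α)) 
    {x : G.toLabelledSpace.Idem} (hx : x ∈ ξ) :
    ∃ a ∈ ξ, ∃ A, a.Is α A ∧ a ≤ x := by
  obtain ⟨A, a, ha, hA⟩ := (isPosetFilter_level hξ h).1
  obtain ⟨w, hw, hwa, hwx⟩ := hξ.2.2.2 a ha x hx
  obtain ⟨δ, D, hD⟩ := Idem.exists_is (hξ.ne_bot hw)
  obtain ⟨n, hn⟩ := h.2.2 w hw δ D hD
  have h1 := ((hD.le_iff hA).1 hwa).1
  have h2 : δ <+: α := hn ▸ List.take_prefix n α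
  obtain rfl := h1.eq_of_length_le h2.length_le
  exact ⟨w, hw, D, hD, hwx⟩

/-- Suppose `y` meets `a`. A strictly shorter word would give `a ≤ y`, hence `y ∈ ξ`; the word `α`
itself is removed by maximality of the last level, after shrinking `a`; a longer word contributes
its first letter beyond `α` to `T`. -/
theorem exists_mem_is_disjoint {ξ : Set G.toLabelledSpace.Idem} {α : List E} (hξ : IsPosetFilter ξ)
    (h : G.toLabelledSpace.HasWord ξ (.fin α)) 
    (hu : IsPosetUltrafilter (G.toLabelledSpace.level ξ α))
    {Y : Set G.toLabelledSpace.Idem} (hY : Y.Finite) (hYξ : ∀ y ∈ Y, y ∉ ξ)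
    {x : G.toLabelledSpace.Idem} (hx : x ∈ ξ) :
    ∃ a ∈ ξ, ∃ A, a.Is α A ∧ a ≤ x ∧ ∃ T : Set E, T.Finite ∧ ∀ y ∈ Y, Disjoint a y ∨
      ∃ e ∈ T, ∃ β B, y.Is β B ∧ α ++ [e] <+: β := by
  induction Y, hY using Set.Finite.induction_on with
  | empty =>
    obtain ⟨a, ha, A, hA, hax⟩ := exists_mem_is_le hξ h hx
    exact ⟨a, ha, A, hA, hax, ∅, Set.finite_empty, by simp⟩
  | @insert y Y _ _ ih =>
    obtain ⟨a, ha, A, hA, hax, T, hT, hTY⟩ := ih fun y hy => hYξ y (Set.mem_insert_of_mem _ hy)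
    have hyξ := hYξ y (Set.mem_insert _ _)
    by_cases hd : Disjoint a y
    · refine ⟨a, ha, A, hA, hax, T, hT, ?_⟩
      rintro _ (rfl | hy)
      exacts [.inl hd, hTY _ hy]
    have hy0 : y ≠ ⊥ := by
      rintro rfl
      exact hd disjoint_bot_right
    obtain ⟨β, B, hB⟩ := Idem.exists_is hy0
    obtain ⟨δ, h1, h2, -⟩ := exists_common_extension hA hB hd
    rcases eq_or_ne β α with hβ | hβ
    · rw [hβ] at hB
      let B' : G.toLabelledSpace.FamilyBelow α := ⟨B, hB.mem_family, hB.subset_wordRange⟩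
      obtain ⟨C, ⟨c, hc, hC⟩, hCB⟩ :=
        hu.exists_disjoint (y := B') fun hB' => hyξ ((mem_level_iff (A := B') hB).1 hB')
      obtain ⟨a', ha', A', hA', hle⟩ := exists_mem_is_le hξ h (hξ.inf_mem ha hc)
      have hd' : Disjoint a' y := by
        refine disjoint_iff.2 (not_not.1 fun hn => ?_)
        -- Disjoint sets at the same word give disjoint idempotents: a common lower bound would have
        -- its set in `C ∩ B`, or continue along an edge with source in `C ∩ B`.
        obtain ⟨ε, F, hF⟩ := Idem.exists_is hn
        have h3 := (hF.le_iff hC).1 (inf_le_left.trans (hle.trans inf_le_right))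
        have h4 := (hF.le_iff hB).1 inf_le_right
        have hCB' : C.1 ∩ B = ∅ := congrArg Subtype.val hCB.eq_bot
        obtain ⟨⟨γ, rfl⟩, h3⟩ := h3
        rw [List.drop_left] at h3 h4
        rcases γ with _ | ⟨e, γ⟩
        · exact (hF.nonempty.mono (Set.subset_inter h3 h4.2)).ne_empty hCB'
        · exact Set.notMem_empty (G.source e) (hCB' ▸
            ⟨source_mem_of_relRange_nonempty (hF.nonempty.mono h3),
              source_mem_of_relRange_nonempty (hF.nonempty.mono h4.2)⟩)
      refine ⟨a', ha', A', hA', (hle.trans inf_le_left).trans hax, T, hT, ?_⟩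
      rintro _ (rfl | hy)
      · exact .inl hd'
      · exact (hTY _ hy).imp_left fun hd => hd.mono_left (hle.trans inf_le_left)
    rcases List.prefix_or_prefix_of_prefix h1 h2 with ⟨_ | ⟨e, γ⟩, rfl⟩ | ⟨_ | ⟨e, γ⟩, rfl⟩
    · exact absurd (List.append_nil α) hβ
    · refine ⟨a, ha, A, hA, hax, insert e T, hT.insert e, ?_⟩
      rintro _ (rfl | hy)
      · exact .inr ⟨e, Set.mem_insert _ _, _, B, hB, γ, by simp⟩
      · exact (hTY _ hy).imp_right fun ⟨e', he', hh⟩ => ⟨e', Set.mem_insert_of_mem _ he', hh⟩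
    · exact absurd (List.append_nil β).symm hβ
    · exact absurd (hξ.mem_of_le ha (le_of_not_disjoint hA hB hd)) hyξ

/-! ### Sufficiency of the three conditions. -/

theorem isTightFilter_of_exists {ξ : Set G.toLabelledSpace.Idem} {α : List E} (hξ : IsPosetFilter ξ)
    (h : G.toLabelledSpace.HasWord ξ (.fin α)) 
    (hu : IsPosetUltrafilter (G.toLabelledSpace.level ξ α))
    (H : ∀ A ∈ G.toLabelledSpace.level ξ α, ∀ a : G.toLabelledSpace.Idem, a.Is α A.1 →
      ∀ T : Set E, T.Finite → ∃ z : G.toLabelledSpace.Idem, z ≠ ⊥ ∧ z ≤ a ∧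
        ∀ e ∈ T, ∀ y β B, y.Is β B → α ++ [e] <+: β → Disjoint z y) :
    IsTightFilter ξ := by
  refine isTightFilter_iff.2 ⟨hξ, fun x hx Y hY hYξ => ?_⟩
  obtain ⟨a, ha, A, hA, hax, T, hT, hTY⟩ := exists_mem_is_disjoint hξ h hu hY hYξ hx
  obtain ⟨z, hz, hza, hd⟩ :=
    H ⟨A, hA.mem_family, hA.subset_wordRange⟩ ⟨a, ha, hA⟩ a hA T hT
  refine ⟨z, hz, hza.trans hax, fun y hy => ?_⟩
  rcases hTY y hy with h1 | ⟨e, he, β, B, hB, hβ⟩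
  · exact h1.mono_left hza
  · exact hd e he y β B hB hβ

theorem isTightFilter_of_emitted_infinite {ξ : Set G.toLabelledSpace.Idem} {α : List E} (hξ : IsPosetFilter ξ)
    (h : G.toLabelledSpace.HasWord ξ (.fin α)) 
    (hu : IsPosetUltrafilter (G.toLabelledSpace.level ξ α))
    (H : ∀ A ∈ G.toLabelledSpace.level ξ α, (G.emitted A.1).Infinite) : IsTightFilter ξ := by
  refine isTightFilter_of_exists hξ h hu fun A hA a ha T hT => ?_
  -- A letter outside `T` suffices: a word beginning with both `αe` and `αe'` would force `e = e'`.
  obtain ⟨e, he, heT⟩ := (H A hA).exists_notMem_finite hT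
  have heA : G.source e ∈ A.1 := he
  obtain ⟨z, hz⟩ := exists_is_range (A.2.2 heA)
  refine ⟨z, hz.ne_bot, le_of_source_mem hz ha heA, fun e' he' y β B hB hβ => ?_⟩
  by_contra hd
  obtain ⟨δ, h1, h2, -⟩ := exists_common_extension hz hB hd
  have heq := (List.prefix_of_prefix_length_le h1 (hβ.trans h2) (by simp)).eq_of_length (by simp)
  rw [List.append_cancel_left_eq, List.singleton_inj] at heq
  exact heT (heq ▸ he')

/-- No word continues from a sink, so its idempotent avoids all words longer than `α` at once,
whatever `T` is. -/
theorem isTightFilter_of_sinks_nonempty {ξ : Set G.toLabelledSpace.Idem} {α : List E} (hξ : IsPosetFilter ξ)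
    (h : G.toLabelledSpace.HasWord ξ (.fin α)) 
    (hu : IsPosetUltrafilter (G.toLabelledSpace.level ξ α))
    (H : ∀ A ∈ G.toLabelledSpace.level ξ α, (A.1 ∩ G.sinks).Nonempty) : IsTightFilter ξ := by
  refine isTightFilter_of_exists hξ h hu fun A hA a ha T _ => ?_
  obtain ⟨v, hvA, hv⟩ := H A hA
  obtain ⟨z, hz⟩ := exists_is_singleton (A.2.2 hvA)
  exact ⟨z, hz.ne_bot, (hz.le_iff_subset ha).2 (Set.singleton_subset_iff.2 hvA),
    fun e _ y β B hB hβ => disjoint_of_sink hv hz hB hβ⟩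

theorem isTightFilter_of_level_eq {ξ : Set G.toLabelledSpace.Idem} {α : List E}
    (hξ : IsPosetFilter ξ) (h : G.toLabelledSpace.HasWord ξ (.fin α)) {v : V}
    (hv : v ∈ G.sinks) (hl : G.toLabelledSpace.level ξ α = {A | {v} ⊆ A.1}) :
    IsTightFilter ξ := by
  -- Some member of the last level contains `v`, which places `v` in the range of `α`.
  obtain ⟨A, hA⟩ := (isPosetFilter_level hξ h).1
  rw [hl] at hA
  obtain ⟨z, hz⟩ := exists_is_singleton (A.2.2 (hA rfl))
  refine hξ.isTightFilter_of_isAtom_mem (isAtom_of_sink hv hz) ?_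
  refine (mem_level_iff (A := ⟨{v}, hz.mem_family, hz.subset_wordRange⟩) hz).1 ?_
  rw [hl]
  exact Set.Subset.rfl

/-! ### Necessity: the last level of a tight filter. -/

theorem relRange_subset_union (A B : Set V) (α : List E) : G.toLabelledSpace.relRange A α ⊆
    G.toLabelledSpace.relRange (A ∩ B) α ∪ G.toLabelledSpace.relRange (A \ B) α := by
  intro c hc
  rcases α with _ | ⟨e, α⟩
  · by_cases hB : c ∈ B
    exacts [.inl ⟨hc, hB⟩, .inr ⟨hc, hB⟩]
  · have he := source_mem_of_relRange_nonempty ⟨c, hc⟩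
    by_cases hB : G.source e ∈ B
    · exact .inl (relRange_cons_eq (B := A ∩ B) he ⟨he, hB⟩ α ▸ hc)
    · exact .inr (relRange_cons_eq (B := A \ B) he ⟨he, hB⟩ α ▸ hc)

/-- The last level of a tight filter of finite type is prime. -/
theorem mem_inter_or_mem_diff {ξ : Set G.toLabelledSpace.Idem} {α : List E}
    (ht : IsTightFilter ξ) {a : G.toLabelledSpace.Idem} (ha : a ∈ ξ) {A : Set V}
    (hA : a.Is α A) {B : Set V} (hB : B ∈ G.toLabelledSpace.family) :
    ∃ y ∈ ξ, y.Is α (A ∩ B) ∨ y.Is α (A \ B) := by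
  by_contra! hn
  -- The two pieces of `A` cover `a`: a point in the set of any `z ≤ a` lies in the relative range
  -- of one of them. An empty piece contributes no idempotent.
  obtain ⟨z, hz0, hza, hd⟩ := (isTightFilter_iff.1 ht).2 a ha
    ({y | y.Is α (A ∩ B)} ∪ {y | y.Is α (A \ B)})
    ((finite_setOf_is _ _).union (finite_setOf_is _ _))
    fun y hy hyξ => hy.elim (hn y hyξ).1 (hn y hyξ).2
  obtain ⟨γ, C, hz⟩ := Idem.exists_is hz0
  obtain ⟨hγ, hC⟩ := (hz.le_iff hA).1 hza
  obtain ⟨c, hc⟩ := hz.nonempty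
  have key : ∀ S : Set V, S ∈ G.toLabelledSpace.family → S ⊆ A →
      c ∈ G.toLabelledSpace.relRange S (γ.drop α.length) →
      ∃ y : G.toLabelledSpace.Idem, y.Is α S ∧ ¬ Disjoint z y := by
    intro S hS hSA hcS
    have hne : S.Nonempty := by
      rw [Set.nonempty_iff_ne_empty]
      rintro rfl
      rw [LabelledGraph.relRange_empty] at hcS
      exact hcS
    obtain ⟨y, hy⟩ := exists_idem_is hS (hSA.trans hA.subset_wordRange) hne
    exact ⟨y, hy, not_disjoint_of_nonempty hz hy hγ ⟨c, hc, hcS⟩⟩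
  rcases relRange_subset_union A B _ (hC hc) with h1 | h1
  · obtain ⟨y, hy, hyd⟩ := key _ (G.toLabelledSpace.inter_mem _ hA.mem_family _ hB)
      Set.inter_subset_left h1
    exact hyd (hd y (.inl hy))
  · obtain ⟨y, hy, hyd⟩ := key _ (G.toLabelledSpace.diff_mem _ hA.mem_family _ hB)
      Set.sdiff_subset h1
    exact hyd (hd y (.inr hy))

/-- Primeness gives maximality because relative complements are available: if a larger filter
contained `B` while `A \ B` was in the level, it would contain two disjoint sets. -/
theorem isPosetUltrafilter_level {ξ : Set G.toLabelledSpace.Idem} {α : List E} (hξ : IsPosetFilter ξ)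
    (h : G.toLabelledSpace.HasWord ξ (.fin α)) 
    (ht : IsTightFilter ξ) : IsPosetUltrafilter (G.toLabelledSpace.level ξ α) := by
  have hF := isPosetFilter_level hξ h
  refine ⟨hF, fun η hη hle => hle.antisymm fun B hB => ?_⟩
  obtain ⟨A, hAF⟩ := hF.1
  obtain ⟨a, ha, hA⟩ := hAF
  obtain ⟨y, hy, hyB⟩ := mem_inter_or_mem_diff ht ha hA B.2.1
  rcases hyB with hyB | hyB
  · exact hF.mem_of_le (x := A ⊓ B) ⟨y, hy, hyB⟩ inf_le_right
  · let D : G.toLabelledSpace.FamilyBelow α := ⟨A.1 \ B.1, hyB.mem_family, hyB.subset_wordRange⟩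
    have hD : D ∈ η := hle ⟨y, hy, hyB⟩
    refine absurd (disjoint_iff.2 (Subtype.ext ?_)) (hη.not_disjoint hD hB)
    exact Set.sdiff_inter_self

theorem level_eq_of_singleton_mem {ξ : Set G.toLabelledSpace.Idem} {α : List E} (hξ : IsPosetFilter ξ)
    (h : G.toLabelledSpace.HasWord ξ (.fin α)) 
    {v : V} {y : G.toLabelledSpace.Idem} (hy : y ∈ ξ) (hv : y.Is α {v}) :
    G.toLabelledSpace.level ξ α = {A | {v} ⊆ A.1} := by
  have hF := isPosetFilter_level hξ h
  let S : G.toLabelledSpace.FamilyBelow α := ⟨{v}, hv.mem_family, hv.subset_wordRange⟩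
  have hS : S ∈ G.toLabelledSpace.level ξ α := ⟨y, hy, hv⟩
  ext A
  refine ⟨fun hA => ?_, fun hA => hF.mem_of_le hS hA⟩
  obtain ⟨x, hxS, hxA⟩ := familyBelow_ne_bot_iff.1 (hF.ne_bot (hF.inf_mem hS hA))
  obtain rfl : x = v := hxS
  exact Set.singleton_subset_iff.2 hxA

/-- If a tight filter of finite type has an element emitting finitely many edges and with finitely
many sinks, then it is the filter of a sink. -/
theorem exists_level_eq_of_finite {ξ : Set G.toLabelledSpace.Idem} {α : List E} (hξ : IsPosetFilter ξ)
    (h : G.toLabelledSpace.HasWord ξ (.fin α)) 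
    (ht : IsTightFilter ξ) {A : G.toLabelledSpace.FamilyBelow α}
    (hA : A ∈ G.toLabelledSpace.level ξ α) (he : (G.emitted A.1).Finite)
    (hs : (A.1 ∩ G.sinks).Finite) :
    ∃ x ∈ G.sinks, G.toLabelledSpace.level ξ α = {A | {x} ⊆ A.1} := by
  obtain ⟨a, ha, haA⟩ := hA
  suffices H : ∃ y ∈ ξ, ∃ v ∈ A.1 ∩ G.sinks, y.Is α {v} by
    obtain ⟨y, hy, v, hv, hyv⟩ := H
    exact ⟨v, hv.2, level_eq_of_singleton_mem hξ h hy hyv⟩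
  by_contra! hn
  -- The finite cover of `a` consists of the emitted edges, whose words are too long for `ξ`, and
  -- the sinks, which are outside `ξ` by assumption.
  obtain ⟨z, hz0, hza, hd⟩ := (isTightFilter_iff.1 ht).2 a ha
    ((⋃ e ∈ G.emitted A.1, {y | y.Is (α ++ [e]) (G.range e)}) ∪
      ⋃ v ∈ A.1 ∩ G.sinks, {y | y.Is α {v}})
    ((he.biUnion fun _ _ => finite_setOf_is _ _).union
      (hs.biUnion fun _ _ => finite_setOf_is _ _)) (by
    rintro y (hy | hy) hyξ
    · obtain ⟨e, -, hy⟩ := Set.mem_iUnion₂.1 hy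
      obtain ⟨n, hn⟩ := h.2.2 y hyξ _ _ hy
      have hp : α ++ [e] <+: α := hn ▸ List.take_prefix n α
      simpa using hp.length_le
    · obtain ⟨v, hv, hy⟩ := Set.mem_iUnion₂.1 hy
      exact hn y hyξ v hv hy)
  obtain ⟨γ, C, hz⟩ := Idem.exists_is hz0
  obtain ⟨⟨γ, rfl⟩, hC⟩ := (hz.le_iff haA).1 hza
  rw [List.drop_left] at hC
  obtain ⟨c, hc⟩ := hz.nonempty
  have hrange : ∀ e, G.source e ∈ A.1 → ∀ y : G.toLabelledSpace.Idem,
      y.Is (α ++ [e]) (G.range e) → Disjoint z y := fun e he y hy =>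
    hd y (.inl (Set.mem_iUnion₂.2 ⟨e, he, hy⟩))
  -- Every non-zero `z ≤ a` meets the cover. With word `α`, a point of its set is a sink or emits an
  -- edge; with a longer word, its first letter beyond `α` is an edge emitted by `A`.
  rcases γ with _ | ⟨e, γ⟩
  · rw [List.append_nil] at hz
    have hcA : c ∈ A.1 := hC hc
    by_cases hcs : c ∈ G.sinks
    · obtain ⟨y, hy⟩ := exists_is_singleton (A.2.2 hcA)
      refine not_disjoint_of_nonempty hz hy (List.prefix_refl _) ?_
        (hd y (.inr (Set.mem_iUnion₂.2 ⟨c, ⟨hcA, hcs⟩, hy⟩)))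
      rw [List.drop_length]
      exact ⟨c, hc, rfl⟩
    · obtain ⟨e, rfl⟩ : ∃ e, G.source e = c := by
        by_contra! hne
        exact hcs hne
      obtain ⟨y, hy⟩ := exists_is_range (A.2.2 hcA)
      refine not_disjoint_of_nonempty hy hz (List.prefix_append _ _) ?_ (hrange e hcA y hy).symm
      rw [List.drop_left, relRange_singleton hc, Set.inter_self]
      exact G.range_nonempty e
  · have heA := source_mem_of_relRange_nonempty ⟨c, hC hc⟩
    obtain ⟨y, hy⟩ := exists_is_range (A.2.2 heA)
    refine not_disjoint_of_nonempty hz hy ⟨γ, by simp⟩ ⟨c, hc, ?_⟩ (hrange e heA y hy)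
    have hcC := hC hc
    rw [show (α ++ e :: γ).drop (α ++ [e]).length = γ by simp [List.drop_append]]
    exact (G.relRange_cons_of_mem heA γ) ▸ hcC

end Ultragraph

theorem mainTheorem9 {V : Type u} {E : Type v} [Countable V] [Countable E]
    (G : Ultragraph V E) :
    (∀ α : ℕ → E, G.IsInfinitePath α →
      ∃! ξ : Set G.toLabelledSpace.Idem,
        IsTightFilter ξ ∧ G.toLabelledSpace.HasWord ξ (.inf α)) ∧
    ∀ (ξ : Set G.toLabelledSpace.Idem) (α : List E), IsPosetFilter ξ →
      G.toLabelledSpace.HasWord ξ (.fin α) →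
      (IsTightFilter ξ ↔
        (∃ x ∈ G.sinks, G.toLabelledSpace.level ξ α = {A | {x} ⊆ A.1}) ∨
        (IsPosetUltrafilter (G.toLabelledSpace.level ξ α) ∧
          ∀ A ∈ G.toLabelledSpace.level ξ α, (G.emitted A.1).Infinite) ∨
        (IsPosetUltrafilter (G.toLabelledSpace.level ξ α) ∧
          ∀ A ∈ G.toLabelledSpace.level ξ α, (A.1 ∩ G.sinks).Infinite)) := by
  refine ⟨fun α hα => ⟨G.pathFilter α, ⟨hα.isPosetUltrafilter.isTightFilter, hα.hasWord⟩,
    fun ξ hξ => Ultragraph.eq_pathFilter (isTightFilter_iff.1 hξ.1).1 hξ.2⟩,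
    fun ξ α hξ h => ⟨fun ht => ?_, ?_⟩⟩
  · have hu := Ultragraph.isPosetUltrafilter_level hξ h ht
    by_cases h2 : ∀ A ∈ G.toLabelledSpace.level ξ α, (G.emitted A.1).Infinite
    · exact .inr (.inl ⟨hu, h2⟩)
    by_cases h3 : ∀ A ∈ G.toLabelledSpace.level ξ α, (A.1 ∩ G.sinks).Infinite
    · exact .inr (.inr ⟨hu, h3⟩)
    push Not at h2 h3
    obtain ⟨A, hA, hAe⟩ := h2
    obtain ⟨B, hB, hBs⟩ := h3
    -- Conditions (ii) and (iii) may fail at different sets; their meet inherits both finiteness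
    -- properties.
    exact .inl (Ultragraph.exists_level_eq_of_finite hξ h ht (hu.1.inf_mem hA hB)
      (hAe.subset fun e he => he.1) (hBs.subset fun v hv => ⟨hv.1.2, hv.2⟩))
  · rintro (⟨v, hv, hl⟩ | ⟨hu, H⟩ | ⟨hu, H⟩)
    · exact Ultragraph.isTightFilter_of_level_eq hξ h hv hl
    · exact Ultragraph.isTightFilter_of_emitted_infinite hξ h hu H
    · exact Ultragraph.isTightFilter_of_sinks_nonempty hξ h hu fun A hA => (H A hA).nonempty
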